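/- Let $M=T^4=(S^1)^4$, $S^1=\mathbb R/2\pi\mathbb Z$, with angles $\theta_1,\dots,\theta_4$, let $\eta=d\theta_3\wedge d\theta_4$, let $G$ be the span of $\partial_{\theta_3},\partial_{\theta_4}$, and let $\pi=\partial_{\theta_3}\wedge\partial_{\theta_4}$. Notation. A closed 2-form $\zeta$ is pre-symplectic of rank $k$ if $\zeta^\sharp\colon TM\to T^*M$, $v\mapsto\zeta(v,\cdot)$, has constant rank $k$. Put $K=\ker\eta^\sharp$, and let $\Omega_{\mathrm{hor}}(M)$ be the space of smooth forms whose restriction to $K$ vanishes, with cohomology $H^k_{\mathrm{hor}}=\{\text{closed horizontal }k\text{-forms}\}/d\Omega^{k-1}_{\mathrm{hor}}(M)$. For a bivector field $Z$ let $\mathcal L_Z=\iota_Z d-d\,\iota_Z$ (with $\iota_{X\wedge Y}=\iota_X\iota_Y$) and $$[\alpha,\beta]_Z=(-1)^{|\alpha|+1}\big(\mathcal L_Z(\alpha\wedge\beta)-\mathcal L_Z(\alpha)\wedge\beta-(-1)^{|\alpha|}\alpha\wedge\mathcal L_Z(\beta)\big).$$ The Koszul $L_\infty[1]$-algebra of $(M,\eta)$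 is $\Omega_{\mathrm{hor}}(M)[2]$ with $\lambda_1=d$, $\lambda_2(\alpha,\beta)=(-1)^{|\alpha|}[\alpha,\beta]_\pi$ and $\lambda_3(\alpha,\beta,\gamma)=(-1)^{|\beta|+1}(\alpha^\sharp\wedge\beta^\sharp\wedge\gamma^\sharp)(\tfrac12[\pi,\pi])$, where $(\alpha^\sharp\wedge\beta^\sharp\wedge\gamma^\sharp)(v_1\wedge v_2\wedge v_3)=\sum_{\sigma\in S_3}\mathrm{sgn}(\sigma)\,\iota_{v_{\sigma(1)}}\alpha\wedge\iota_{v_{\sigma(2)}}\beta\wedge\iota_{v_{\sigma(3)}}\gamma$. Its $H^0$ and $H^1$ are $H^2_{\mathrm{hor}}$ and $H^3_{\mathrm{hor}}$. A Maurer–Cartan element is a $\beta\in\Omega^2_{\mathrm{hor}}(M)$ with $d\beta+\tfrac12\lambda_2(\beta,\beta)+\tfrac16\lambda_3(\beta,\beta,\beta)=0$; a formal curve of Maurer–Cartan elements is a series $\sum_{n\ge1}w_nt^n$, $w_n\in\Omega^2_{\mathrm{hor}}(M)$, satisfying this equation coefficientwise. Claim. (1) $\eta$ is pre-symplectic of rank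 2, $K$ is spanned by $\partial_{\theta_1},\partial_{\theta_2}$, $TM=K\oplus G$, and $\pi\in\Gamma(\wedge^2G)$ satisfies $\pi^\sharp=-(\eta^\sharp|_G)^{-1}$. (2) The Kuranishi map $\mathrm{Kr}\colon H^2_{\mathrm{hor}}\to H^3_{\mathrm{hor}}$, $[w]\mapsto[\lambda_2(w,w)]$, is well defined. (3) For all smooth $f,g\colon S^1\to\mathbb R$, the form $B=f(\theta_3)\,d\theta_1\wedge d\theta_3+g(\theta_4)\,d\theta_2\wedge d\theta_4$ is closed and horizontal, $$\lambda_2(B,B)=[B,B]_\pi=2\big(f(\theta_3)g'(\theta_4)\,d\theta_1\wedge d\theta_2\wedge d\theta_4+g(\theta_4)f'(\theta_3)\,d\theta_1\wedge d\theta_2\wedge d\theta_3\big),$$ this 3-form is exact in $\Omega(M)$, and $\mathrm{Kr}([B])\ne0$ whenever $g(0)(f(b)-f(a))\neq0$ for some $a,b\in S^1$. (4) For $f=g=\cos$, that is $B=\cos(\theta_3)\,d\theta_1\wedge d\theta_3+\cos(\theta_4)\,d\theta_2\wedge d\theta_4$, one has $\mathrm{Kr}([B])\neq0$, and the infinitesimal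 deformation $[B]$ is formally and smoothly obstructed. That is, for every closed horizontal 2-form $w$ with $[w]=[B]$ in $H^2_{\mathrm{hor}}$: (a) there is no formal curve of Maurer–Cartan elements $\sum_{n\ge1}w_nt^n$ with $w_1=w$; (b) there are no $\varepsilon>0$ and smooth family $(\beta_t)_{t\in[0,\varepsilon)}$ of Maurer–Cartan elements with $\beta_0=0$ and $\frac{d}{dt}\big|_{t=0}\beta_t=w$; (c) there are no $\varepsilon>0$ and smooth family $(\eta_t)_{t\in[0,\varepsilon)}$ of pre-symplectic forms of rank 2 with $\eta_0=\eta$ and $\frac{d}{dt}\big|_{t=0}\eta_t=w$. -/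

import Mathlib

open scoped ContDiff

noncomputable section

namespace KoszulTorus

/-! ### Differential forms on the torus `T⁴ = (S¹)⁴`, `S¹ = ℝ / 2πℤ`

The covering `proj : ℝ⁴ → T⁴` is a local diffeomorphism, and its derivative identifies every tangent
space of `T⁴` with `ℝ⁴` (the frame `∂/∂θ₁, …, ∂/∂θ₄`). The angles `θ₁, …, θ₄` are indexed by
`0, …, 3`. -/

/-- The circle `S¹ = ℝ / 2πℤ`. -/
abbrev S1 : Type := AddCircle (2 * Real.pi)

/-- The four-dimensional torus. -/
abbrev T4 : Type := Fin 4 → S1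

/-- The tangent space of `T⁴` at any point. -/
abbrev V : Type := Fin 4 → ℝ

/-- The coordinate vector `∂/∂θᵢ`. -/
def e (i : Fin 4) : V := Pi.single i 1

/-- The universal covering `ℝ⁴ → T⁴`. -/
def proj (x : V) : T4 := fun i => (x i : S1)

lemma proj_surjective : Function.Surjective proj := by
  intro q
  choose x hx using fun i => QuotientAddGroup.mk_surjective (q i)
  exact ⟨x, funext hx⟩

/-- A point of `ℝ⁴` above a given point of `T⁴`. -/
def lift (q : T4) : V := Function.surjInv proj_surjective q

lemma proj_lift (q : T4) : proj (lift q) = q := Function.surjInv_eq proj_surjective q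

lemma proj_add_of_eq {x y : V} (h : proj x = proj y) (z : V) :
    proj (z + (y - x)) = proj z := by
  funext i
  have hi : (x i : S1) = (y i : S1) := congrFun h i
  simp [proj, hi]

/-- The derivative of the lift of a map on `T⁴` depends only on the point of `T⁴`. -/
lemma fderiv_proj {W : Type*} [NormedAddCommGroup W] [NormedSpace ℝ W] (F : T4 → W) (x : V) :
    fderiv ℝ (fun z => F (proj z)) (lift (proj x)) = fderiv ℝ (fun z => F (proj z)) x := by
  have h : proj x = proj (lift (proj x)) := (proj_lift _).symm
  have h1 := fderiv_comp_add_right (𝕜 := ℝ) (f := fun z => F (proj z)) (x := x)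
    (lift (proj x) - x)
  have h2 : (fun z => F (proj (z + (lift (proj x) - x)))) = fun z => F (proj z) :=
    funext fun z => congrArg F (proj_add_of_eq h z)
  rw [h2] at h1
  rw [h1]
  congr 1
  abel

/-- Alternating `k`-forms on the tangent space. -/
abbrev Alt (k : ℕ) : Type := V [⋀^Fin k]→L[ℝ] ℝ

/-- The algebra `C^∞(T⁴)`. -/
def smoothFun : Subalgebra ℝ (T4 → ℝ) where
  carrier := {f | ContDiff ℝ ∞ (fun x => f (proj x))}
  mul_mem' {f g} (hf : ContDiff ℝ ∞ _) (hg : ContDiff ℝ ∞ _) := by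
    change ContDiff ℝ ∞ (fun x => f (proj x) * g (proj x))
    exact hf.mul hg
  add_mem' {f g} (hf : ContDiff ℝ ∞ _) (hg : ContDiff ℝ ∞ _) := by
    change ContDiff ℝ ∞ (fun x => f (proj x) + g (proj x))
    exact hf.add hg
  algebraMap_mem' c := by
    change ContDiff ℝ ∞ (fun _ : V => c)
    exact contDiff_const

/-- The space `Ω^k(T⁴)` of smooth differential `k`-forms. -/
def formSpace (k : ℕ) : Submodule ℝ (T4 → Alt k) where
  carrier := {om | ContDiff ℝ ∞ (fun x => om (proj x))}
  zero_mem' := by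
    change ContDiff ℝ ∞ (fun _ : V => (0 : Alt k))
    exact contDiff_const
  add_mem' {a b} (ha : ContDiff ℝ ∞ _) (hb : ContDiff ℝ ∞ _) := by
    change ContDiff ℝ ∞ (fun x => a (proj x) + b (proj x))
    exact ha.add hb
  smul_mem' c a (ha : ContDiff ℝ ∞ _) := by
    change ContDiff ℝ ∞ (fun x => c • a (proj x))
    exact ha.const_smul c

/-- A smooth differential `k`-form on `T⁴`. -/
def Form (k : ℕ) : Type := formSpace k

instance (k : ℕ) : AddCommGroup (Form k) := (formSpace k).addCommGroup

instance (k : ℕ) : Module ℝ (Form k) := (formSpace k).module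


lemma Form.smooth {k : ℕ} (om : Form k) : ContDiff ℝ ∞ (fun x => om.1 (proj x)) := om.2

lemma smul_smooth {k : ℕ} {f : T4 → ℝ} (hf : f ∈ smoothFun) {om : T4 → Alt k}
    (hom : om ∈ formSpace k) : (fun q => f q • om q) ∈ formSpace k := by
  have hf' : ContDiff ℝ ∞ (fun x => f (proj x)) := hf
  have hom' : ContDiff ℝ ∞ (fun x => om (proj x)) := hom
  change ContDiff ℝ ∞ (fun x => f (proj x) • om (proj x))
  exact hf'.smul hom'

lemma const_smooth {k : ℕ} (a : Alt k) : (fun _ => a) ∈ formSpace k := by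
  change ContDiff ℝ ∞ (fun _ : V => a)
  exact contDiff_const

/-! ### de Rham differential -/

lemma extDeriv_lift_proj {k : ℕ} (om : T4 → Alt k) (x : V) :
    extDeriv (fun z => om (proj z)) (lift (proj x)) = extDeriv (fun z => om (proj z)) x := by
  unfold extDeriv
  rw [fderiv_proj]

lemma contDiff_extDeriv {k : ℕ} {om : V → Alt k} (h : ContDiff ℝ ∞ om) :
    ContDiff ℝ ∞ (extDeriv om) := by
  have h1 : ContDiff ℝ ∞ (fderiv ℝ om) := h.fderiv_right (by simp)
  exact (ContinuousAlternatingMap.alternatizeUncurryFinCLM ℝ V ℝ (n := k)).contDiff.comp h1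

/-- The de Rham differential `d : Ω^k(T⁴) → Ω^{k+1}(T⁴)`. -/
def d {k : ℕ} : Form k →ₗ[ℝ] Form (k + 1) where
  toFun om := ⟨fun q => extDeriv (fun x => om.1 (proj x)) (lift q), by
    have h := contDiff_extDeriv om.smooth
    change ContDiff ℝ ∞ _
    simpa only [extDeriv_lift_proj] using h⟩
  map_add' om om' := by
    refine Subtype.ext (funext fun q => ?_)
    exact extDeriv_add (om.smooth.differentiable (by simp)).differentiableAt
      (om'.smooth.differentiable (by simp)).differentiableAt
  map_smul' c om := by
    refine Subtype.ext (funext fun q => ?_)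
    exact extDeriv_smul c _

/-- In the coordinates `θᵢ`, `d` is the usual exterior derivative. -/
lemma d_apply_proj {k : ℕ} (om : Form k) (x : V) :
    (d om).1 (proj x) = extDeriv (fun z => om.1 (proj z)) x :=
  extDeriv_lift_proj om.1 x

/-! ### Wedge product -/

/-- `(α ⊗ β)(v₁, …, v_{r+s}) = α(v₁, …, v_r) β(v_{r+1}, …, v_{r+s})`. -/
def tensorAlt {r s n : ℕ} (h : r + s = n) (α : Alt r) (β : Alt s) :
    ContinuousMultilinearMap ℝ (fun _ : Fin n => V) ℝ where
  toMultilinearMap :=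
    ((LinearMap.mul' ℝ ℝ).compMultilinearMap
      (α.toMultilinearMap.domCoprod β.toMultilinearMap)).domDomCongr
        (finSumFinEquiv.trans (finCongr h))
  cont := by
    change Continuous fun v : Fin n → V =>
      α (fun i => v (finCongr h (finSumFinEquiv (Sum.inl i)))) *
        β (fun i => v (finCongr h (finSumFinEquiv (Sum.inr i))))
    exact (α.cont.comp (by fun_prop)).mul (β.cont.comp (by fun_prop))

lemma tensorAlt_apply {r s n : ℕ} (h : r + s = n) (α : Alt r) (β : Alt s) (v : Fin n → V) :
    tensorAlt h α β v = α (fun i => v (Fin.cast h (Fin.castAdd s i))) *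
      β (fun i => v (Fin.cast h (Fin.natAdd r i))) := rfl

/-- Wedge product of alternating forms; `n` is the total degree:
`(α ∧ β)(v) = 1/(r! s!) ∑_σ sgn(σ) α(v_{σ(1)}, …, v_{σ(r)}) β(v_{σ(r+1)}, …, v_{σ(r+s)})`. -/
def wedgeAlt {r s n : ℕ} (h : r + s = n) (α : Alt r) (β : Alt s) : Alt n :=
  ((r.factorial * s.factorial : ℝ)⁻¹) •
    ContinuousMultilinearMap.alternatization (tensorAlt h α β)

lemma wedgeAlt_apply {r s n : ℕ} (h : r + s = n) (α : Alt r) (β : Alt s) (v : Fin n → V) :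
    wedgeAlt h α β v = ((r.factorial * s.factorial : ℝ)⁻¹) *
      ∑ σ : Equiv.Perm (Fin n), ((Equiv.Perm.sign σ : ℤ) : ℝ) *
        (α (fun i => v (σ (Fin.cast h (Fin.castAdd s i)))) *
          β (fun i => v (σ (Fin.cast h (Fin.natAdd r i))))) := by
  simp only [wedgeAlt, ContinuousAlternatingMap.smul_apply,
    ContinuousMultilinearMap.alternatization_apply_apply, tensorAlt_apply, smul_eq_mul,
    Function.comp_apply]
  congr 1
  refine Finset.sum_congr rfl fun σ _ => ?_
  rw [Units.smul_def, zsmul_eq_mul]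

instance (k : ℕ) : FiniteDimensional ℝ (Alt k) :=
  FiniteDimensional.of_injective
    ({ toFun := fun f => f.toMultilinearMap
       map_add' := fun _ _ => rfl
       map_smul' := fun _ _ => rfl } :
      Alt k →ₗ[ℝ] MultilinearMap ℝ (fun _ : Fin k => V) ℝ)
    (fun f g h => by
      ext v
      exact congrArg (fun m : MultilinearMap ℝ (fun _ : Fin k => V) ℝ => m v) h)

lemma isBilinearMap_wedgeAlt {r s n : ℕ} (h : r + s = n) :
    IsBilinearMap ℝ (fun (α : Alt r) (β : Alt s) => wedgeAlt h α β) where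
  add_left a a' b := by
    ext v
    simp only [wedgeAlt_apply, ContinuousAlternatingMap.add_apply, add_mul, mul_add,
      Finset.sum_add_distrib]
  smul_left c a b := by
    ext v
    simp only [wedgeAlt_apply, ContinuousAlternatingMap.smul_apply, smul_eq_mul, Finset.mul_sum]
    exact Finset.sum_congr rfl fun σ _ => by ring
  add_right a b b' := by
    ext v
    simp only [wedgeAlt_apply, ContinuousAlternatingMap.add_apply, mul_add,
      Finset.sum_add_distrib]
  smul_right c a b := by
    ext v
    simp only [wedgeAlt_apply, ContinuousAlternatingMap.smul_apply, smul_eq_mul, Finset.mul_sum]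
    exact Finset.sum_congr rfl fun σ _ => by ring

/-- Wedge product of differential forms; `n` is the total degree. -/
def wedge {r s n : ℕ} (h : r + s = n) (α : Form r) (β : Form s) : Form n :=
  ⟨fun q => wedgeAlt h (α.1 q) (β.1 q), by
    change ContDiff ℝ ∞ (fun x =>
      (isBilinearMap_wedgeAlt h).toContinuousBilinearMap (α.1 (proj x)) (β.1 (proj x)))
    exact ((isBilinearMap_wedgeAlt h).toContinuousBilinearMap.contDiff.comp
      (Form.smooth α)).clm_apply (Form.smooth β)⟩

/-! ### Contraction with, and Lie derivative along, a bivector field -/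

/-- Contraction with a constant vector field: `(ι_v om)(v₁, …, v_k) = om(v, v₁, …, v_k)`. -/
def contrVec {k : ℕ} (v : V) (om : Form (k + 1)) : Form k :=
  ⟨fun q => (om.1 q).curryLeft v,
    ((ContinuousLinearMap.apply ℝ (Alt k) v).comp
      (ContinuousAlternatingMap.curryLeftLI (𝕜 := ℝ) (E := V) (F := ℝ)
        (n := k)).toContinuousLinearMap).contDiff.comp om.smooth⟩

/-- Multiplication of a form by a smooth function. -/
def fmul {k : ℕ} (f : smoothFun) (om : Form k) : Form k :=
  ⟨fun q => f.1 q • om.1 q, smul_smooth f.2 om.2⟩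

/-- The derivative `∂f/∂θ_l`. -/
def pderiv (l : Fin 4) (f : smoothFun) : smoothFun :=
  ⟨fun q => fderiv ℝ (fun x => f.1 (proj x)) (lift q) (e l), by
    change ContDiff ℝ ∞ _
    simp only [fderiv_proj]
    have hf : ContDiff ℝ ∞ (fun x => f.1 (proj x)) := f.2
    exact (hf.fderiv_right (m := ∞) (by simp)).clm_apply contDiff_const⟩

/-- A smooth bivector field `Z = ∑_{i<j} Z^{ij} ∂ᵢ ∧ ∂ⱼ` on `T⁴`, given by its components in the
global frame `∂/∂θ₁, …, ∂/∂θ₄`. -/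
structure Bivector where
  comp : Fin 4 → Fin 4 → smoothFun
  antisymm : ∀ i j, comp i j = -comp j i

/-- `Z♯ : T*M → TM`, `ξ ↦ Z(ξ, ·)`. -/
def Bivector.sharp (Z : Bivector) (q : T4) : (V →L[ℝ] ℝ) →ₗ[ℝ] V where
  toFun ξ := ∑ i, ∑ j, ((Z.comp i j).1 q * ξ (e i)) • e j
  map_add' ξ ξ' := by
    simp only [add_apply, mul_add, add_smul, Finset.sum_add_distrib]
  map_smul' c ξ := by
    simp only [smul_apply, smul_eq_mul, Finset.smul_sum, smul_smul,
      RingHom.id_apply]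
    exact Finset.sum_congr rfl fun i _ => Finset.sum_congr rfl fun j _ => by ring_nf

/-- Contraction `ι_Z : Ω^{k+2} → Ω^k`, with the convention `ι_{X ∧ Y} = ι_X ∘ ι_Y`; for
`Z = ½ ∑ Z^{ij} ∂ᵢ ∧ ∂ⱼ` it is `½ ∑ Z^{ij} ι_{∂ᵢ} ι_{∂ⱼ}`. -/
def contr {k : ℕ} (Z : Bivector) (om : Form (k + 2)) : Form k :=
  (2⁻¹ : ℝ) • ∑ i, ∑ j, fmul (Z.comp i j) (contrVec (e i) (contrVec (e j) om))

/-- The Lie derivative `L_Z = ι_Z ∘ d - d ∘ ι_Z : Ω^{k+1} → Ω^k` (`ι_Z = 0` on 1-forms). -/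
def lieD (Z : Bivector) : {k : ℕ} → Form (k + 1) → Form k
  | 0, om => contr Z (d om)
  | _ + 1, om => contr Z (d om) - d (contr Z om)

/-! ### The Koszul brackets -/

/-- The Koszul bracket of forms of positive degree,
`[α,β]_Z = (-1)^{|α|+1} (L_Z(α ∧ β) - L_Z(α) ∧ β - (-1)^{|α|} α ∧ L_Z(β))`. -/
def koszul (Z : Bivector) {r s : ℕ} (α : Form (r + 1)) (β : Form (s + 1)) : Form (r + s + 1) :=
  (-1 : ℝ) ^ (r + 1 + 1) •
    (lieD Z (wedge (n := r + s + 1 + 1) (by omega) α β)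
      - wedge (by omega) (lieD Z α) β
      - (-1 : ℝ) ^ (r + 1) • wedge (by omega) α (lieD Z β))

/-- Components of `½[Z,Z]` (Schouten–Nijenhuis bracket, `[L_Y, ι_{Y'}] = ι_{[Y,Y']}`) in the frame
`∂/∂θᵢ`: `∑_l (Z^{kl} ∂_l Z^{ij} + Z^{il} ∂_l Z^{jk} + Z^{jl} ∂_l Z^{ki})`. -/
def Bivector.halfSchouten (Z : Bivector) (i j k : Fin 4) : smoothFun :=
  ∑ l, (Z.comp k l * pderiv l (Z.comp i j) + Z.comp i l * pderiv l (Z.comp j k)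
    + Z.comp j l * pderiv l (Z.comp k i))

/-- `(α♯ ∧ β♯ ∧ γ♯)(v₁ ∧ v₂ ∧ v₃) = ∑_σ sgn(σ) ι_{v_{σ(1)}}α ∧ ι_{v_{σ(2)}}β ∧ ι_{v_{σ(3)}}γ`. -/
def sharpWedge {r s t : ℕ} (α : Form (r + 1)) (β : Form (s + 1)) (γ : Form (t + 1))
    (v : Fin 3 → V) : Form (r + s + t) :=
  ∑ σ : Equiv.Perm (Fin 3), ((Equiv.Perm.sign σ : ℤ) : ℝ) •
    wedge rfl (wedge rfl (contrVec (v (σ 0)) α) (contrVec (v (σ 1)) β)) (contrVec (v (σ 2)) γ)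

/-- The trinary bracket `[α,β,γ]_Z = (α♯ ∧ β♯ ∧ γ♯)(½[Z,Z])`; a trivector field with components
`T^{ijk}` is `(1/6) ∑ T^{ijk} ∂ᵢ ∧ ∂ⱼ ∧ ∂ₖ`. -/
def koszul3 (Z : Bivector) {r s t : ℕ} (α : Form (r + 1)) (β : Form (s + 1))
    (γ : Form (t + 1)) : Form (r + s + t) :=
  (6⁻¹ : ℝ) • ∑ i, ∑ j, ∑ k,
    fmul (Z.halfSchouten i j k) (sharpWedge α β γ ![e i, e j, e k])

/-- `λ₂(α[2] ⊙ β[2]) = (-1)^{|α|} [α,β]_Z [2]`. -/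
def lam2 (Z : Bivector) {r s : ℕ} (α : Form (r + 1)) (β : Form (s + 1)) : Form (r + s + 1) :=
  (-1 : ℝ) ^ (r + 1) • koszul Z α β

/-- `λ₃(α[2] ⊙ β[2] ⊙ γ[2]) = (-1)^{|β|+1} (α♯ ∧ β♯ ∧ γ♯)(½[Z,Z]) [2]`. -/
def lam3 (Z : Bivector) {r s t : ℕ} (α : Form (r + 1)) (β : Form (s + 1))
    (γ : Form (t + 1)) : Form (r + s + t) :=
  (-1 : ℝ) ^ (s + 1 + 1) • koszul3 Z α β γ

/-! ### Pre-symplectic forms and horizontal forms -/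

/-- The bundle map `η♯ : TM → T*M`, `v ↦ η(v, ·)`, at the point `q`. -/
def flat (η : Form 2) (q : T4) : V →ₗ[ℝ] (V →L[ℝ] ℝ) where
  toFun v := (ContinuousAlternatingMap.ofSubsingleton ℝ V ℝ (0 : Fin 1)).symm
    ((η.1 q).curryLeft v)
  map_add' v v' := by
    rw [map_add]
    rfl
  map_smul' c v := by
    rw [map_smul]
    rfl

lemma flat_apply (η : Form 2) (q : T4) (v w : V) : flat η q v w = η.1 q ![v, w] := by
  change η.1 q (Matrix.vecCons v fun _ => w) = _
  congr 1
  funext i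
  fin_cases i <;> rfl

/-- The kernel `K = ker η♯` at the point `q`. -/
def kerAt (η : Form 2) (q : T4) : Submodule ℝ V := LinearMap.ker (flat η q)

/-- `η` is a pre-symplectic form of rank `k`: closed, with `η♯` of constant rank `k`. -/
def IsPreSymplectic (k : ℕ) (η : Form 2) : Prop :=
  d η = 0 ∧ ∀ q, Module.finrank ℝ (LinearMap.range (flat η q)) = k

/-- `G` is a complement to the kernel of `η`, and `Z ∈ Γ(∧²G)` is the bivector field determined by
`Z♯ = -(η♯|_G)⁻¹`. -/
def IsNegInverse (η : Form 2) (G : T4 → Submodule ℝ V) (Z : Bivector) : Prop :=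
  ∀ q, IsCompl (kerAt η q) (G q) ∧ LinearMap.range (Z.sharp q) ≤ G q ∧
    ∀ v ∈ G q, Z.sharp q (flat η q v) = -v

/-- `Ω^k_hor(M)`: the `k`-forms whose restriction to `K = ker η♯` vanishes. -/
def horForm (η : Form 2) (k : ℕ) : Submodule ℝ (Form k) where
  carrier := {om | ∀ q (v : Fin k → V), (∀ i, v i ∈ kerAt η q) → om.1 q v = 0}
  zero_mem' := fun _ _ _ => rfl
  add_mem' {a b} ha hb := fun q v hv => by
    change a.1 q v + b.1 q v = 0
    rw [ha q v hv, hb q v hv, add_zero]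
  smul_mem' c a ha := fun q v hv => by
    change c * a.1 q v = 0
    rw [ha q v hv, mul_zero]

/-- The closed horizontal `k`-forms. -/
def closedHor (η : Form 2) (k : ℕ) : Submodule ℝ (Form k) := horForm η k ⊓ LinearMap.ker d

/-- The `(k+1)`-forms that are differentials of horizontal `k`-forms. -/
def exactHor (η : Form 2) (k : ℕ) : Submodule ℝ (Form (k + 1)) := (horForm η k).map d

/-- The cohomology of `(Ω_hor(M), d)` in form degree `k + 1`. In the grading of the Koszul
`L_∞[1]`-algebra `Ω_hor(M)[2]`, form degree `2` is degree `0` and form degree `3` is degree `1`. -/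
abbrev HHor (η : Form 2) (k : ℕ) : Type :=
  closedHor η (k + 1) ⧸ (exactHor η k).submoduleOf (closedHor η (k + 1))

/-- The class of a closed horizontal form. -/
def cls {η : Form 2} {k : ℕ} (w : closedHor η (k + 1)) : HHor η k := Submodule.Quotient.mk w

/-! ### Maurer–Cartan elements and obstructions -/

/-- Maurer–Cartan elements of the Koszul `L_∞[1]`-algebra `Ω_hor(M)[2]`. -/
def IsMC (η : Form 2) (Z : Bivector) (β : Form 2) : Prop :=
  β ∈ horForm η 2 ∧
    d β + (2⁻¹ : ℝ) • lam2 Z β β + (6⁻¹ : ℝ) • lam3 Z β β β = 0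

/-- `∑ wₙ tⁿ` is a formal curve of Maurer–Cartan elements of `Ω_hor(M)[2]` starting at `0`: the
Maurer–Cartan equation holds coefficientwise in powers of `t`. -/
def IsFormalMCCurve (η : Form 2) (Z : Bivector) (w : ℕ → Form 2) : Prop :=
  w 0 = 0 ∧ (∀ n, w n ∈ horForm η 2) ∧
    ∀ n, d (w n)
      + (2⁻¹ : ℝ) • ∑ p ∈ Finset.HasAntidiagonal.antidiagonal n, lam2 Z (w p.1) (w p.2)
      + (6⁻¹ : ℝ) • ∑ p ∈ Finset.HasAntidiagonal.antidiagonal n, ∑ p' ∈ Finset.HasAntidiagonal.antidiagonal p.2,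
          lam3 Z (w p.1) (w p'.1) (w p'.2) = 0

/-- `(βₜ)` is, for `t ∈ [0, ε)`, a smooth one-parameter family of 2-forms (smooth in `(t, θ)`)
with `d/dt|₀ βₜ = w`. -/
def IsSmoothFamily (ε : ℝ) (β : ℝ → Form 2) (w : Form 2) : Prop :=
  ContDiffOn ℝ ∞ (fun p : ℝ × V => (β p.1).1 (proj p.2)) (Set.Ico 0 ε ×ˢ Set.univ) ∧
    ∀ q, HasDerivWithinAt (fun t => (β t).1 q) (w.1 q) (Set.Ici 0) 0

/-- `w` extends to a formal curve of Maurer–Cartan elements. -/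
def ExtendsFormally (η : Form 2) (Z : Bivector) (w : Form 2) : Prop :=
  ∃ u : ℕ → Form 2, IsFormalMCCurve η Z u ∧ u 1 = w

/-- `w` extends to a smooth curve of Maurer–Cartan elements. -/
def ExtendsSmoothly (η : Form 2) (Z : Bivector) (w : Form 2) : Prop :=
  ∃ ε > 0, ∃ β : ℝ → Form 2, IsSmoothFamily ε β w ∧ β 0 = 0 ∧
    ∀ t ∈ Set.Ico 0 ε, IsMC η Z (β t)

/-- `w` is the velocity of a smooth family of pre-symplectic forms of rank `k` starting at `η`. -/
def IsPreSymplecticVelocity (k : ℕ) (η w : Form 2) : Prop :=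
  ∃ ε > 0, ∃ ζ : ℝ → Form 2, IsSmoothFamily ε ζ w ∧ ζ 0 = η ∧
    ∀ t ∈ Set.Ico 0 ε, IsPreSymplectic k (ζ t)

/-! ### The example -/

/-- `dθᵢ` at a point. -/
def dθ (i : Fin 4) : Alt 1 :=
  ContinuousAlternatingMap.ofSubsingleton ℝ V ℝ (0 : Fin 1) (ContinuousLinearMap.proj i)

/-- `dθᵢ ∧ dθⱼ` at a point. -/
def dθ2 (i j : Fin 4) : Alt 2 := wedgeAlt rfl (dθ i) (dθ j)

/-- `dθᵢ ∧ dθⱼ ∧ dθₖ` at a point. -/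
def dθ3 (i j k : Fin 4) : Alt 3 := wedgeAlt rfl (dθ2 i j) (dθ k)

/-- `η = dθ₃ ∧ dθ₄`. -/
def eta : Form 2 := ⟨fun _ => dθ2 2 3, const_smooth _⟩

/-- The span `G` of `∂/∂θ₃` and `∂/∂θ₄`. -/
def G34 : T4 → Submodule ℝ V := fun _ => Submodule.span ℝ {e 2, e 3}

/-- `π = ∂/∂θ₃ ∧ ∂/∂θ₄`. -/
def biv : Bivector where
  comp i j := algebraMap ℝ smoothFun
    ((if i = 2 ∧ j = 3 then 1 else 0) - (if i = 3 ∧ j = 2 then 1 else 0))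
  antisymm i j := by
    rw [← map_neg]
    congr 1
    simp only [and_comm, neg_sub]

/-- Smooth functions on the circle. -/
def IsSmoothS1 (f : S1 → ℝ) : Prop := ContDiff ℝ ∞ (fun t : ℝ => f t)

lemma comp_coord_smooth {f : S1 → ℝ} (hf : IsSmoothS1 f) (i : Fin 4) :
    (fun q : T4 => f (q i)) ∈ smoothFun :=
  ContDiff.comp (g := fun t : ℝ => f t) hf (contDiff_apply ℝ ℝ i)

/-- `B = f(θ₃) dθ₁ ∧ dθ₃ + g(θ₄) dθ₂ ∧ dθ₄`. -/
def formB (f g : S1 → ℝ) (hf : IsSmoothS1 f) (hg : IsSmoothS1 g) : Form 2 :=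
  ⟨fun q => f (q 2) • dθ2 0 2 + g (q 3) • dθ2 1 3,
    (formSpace 2).add_mem
      (smul_smooth (comp_coord_smooth hf 2) (const_smooth _))
      (smul_smooth (comp_coord_smooth hg 3) (const_smooth _))⟩

/-- The cosine on `S¹ = ℝ / 2πℤ`. -/
def cosS1 : S1 → ℝ := Real.cos_periodic.lift

lemma cosS1_smooth : IsSmoothS1 cosS1 := Real.contDiff_cos

end KoszulTorus

end

open KoszulTorus

open scoped ContDiff

noncomputable section

namespace KoszulTorus

/-! ### Coefficients of differential forms -/

/-! Subscripts 1, …, 4 in these comments number the angles; the code's indices are one lower. Forms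
are handled through their coefficients in the ring `C^∞(T⁴)`, with `∂/∂θ_l` as derivations, so that
identities of forms become polynomial identities.

Since `π` is constant, `λ₃ = 0`. For closed `w` one has `λ₂(w,w) = dP(w)` with `P(w) = 2 ι_{∂₃}w ∧
ι_{∂₄}w` (`d_primitive`). Thus `λ₂(w,w)` is always exact; the obstruction is that `P(w)` need not be
horizontal, as `P(w)₁₂ = 2(w₁₃w₂₄ - w₁₄w₂₃)`.

The detector is the integral over the leaf torus `θ₃ = s`, `θ₄ = u` of `K`. It vanishes on
horizontal and on exact 2-forms, and on closed ones it does not depend on `s`, by Stokes. If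
`λ₂(w,w) = dβ` with `β` horizontal, then `P(w) - β` is closed, so the leaf integral of `P(w)` is
independent of `s`. For `B` this integral is `2(2π)² f(s)g(u)`, which varies with `s` as soon as
`g(u) ≠ 0` and `f` is not constant. Adding `dα` with `α` horizontal changes `P(w)` by a horizontal
plus an exact form (`primitive_sub_primitive_sub_d_mem`); this makes the Kuranishi map well defined
and the leaf integral of `P(w)` a class invariant.

A formal curve gives `λ₂(w,w) = d(-2w₂)` at order `t²`, hence a vanishing Kuranishi class. Smooth
families are excluded by conservation laws that hold at each time. A rank-2 form `ζ` has zero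
Pfaffian, so `ζ₁₂ = (ζ₁₃ζ₂₄ - ζ₁₄ζ₂₃)/ζ₃₄`, and closedness makes the leaf integral of this quotient
independent of `s`. For a Maurer–Cartan element the denominator becomes `1 - β₃₄`. Division by `t²`
and `t → 0` carry the law over to `w₁₃w₂₄ - w₁₄w₂₃` (`leafIntegral_mixedPfaffian_eq`), contradicting
the value for `[B]`. -/

lemma eval_smooth {k : ℕ} (om : Form k) (v : Fin k → V) : (fun q => om.1 q v) ∈ smoothFun := by
  change ContDiff ℝ ∞ (fun x => om.1 (proj x) v)
  exact ((ContinuousAlternatingMap.apply ℝ V ℝ v).contDiff).comp om.smooth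

/-- The function `om(v₁, …, v_k)` for constant vector fields `vᵢ`. -/
def Form.eval {k : ℕ} (v : Fin k → V) : Form k →ₗ[ℝ] smoothFun where
  toFun om := ⟨fun q => om.1 q v, eval_smooth om v⟩
  map_add' _ _ := rfl
  map_smul' _ _ := rfl

/-- The coefficient `om(∂ᵢ)`. -/
abbrev coeff1 (om : Form 1) (i : Fin 4) : smoothFun := Form.eval ![e i] om

/-- The coefficient `om(∂ᵢ, ∂ⱼ)`. -/
abbrev coeff2 (om : Form 2) (i j : Fin 4) : smoothFun := Form.eval ![e i, e j] om

/-- The coefficient `om(∂ᵢ, ∂ⱼ, ∂ₖ)`. -/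
abbrev coeff3 (om : Form 3) (i j k : Fin 4) : smoothFun := Form.eval ![e i, e j, e k] om

lemma Form.eval_apply {k : ℕ} (v : Fin k → V) (om : Form k) (q : T4) :
    (Form.eval v om).1 q = om.1 q v := rfl

lemma alt_ext {k : ℕ} {a b : Alt k}
    (h : ∀ I : Fin k → Fin 4, a (fun i => e (I i)) = b (fun i => e (I i))) : a = b := by
  apply ContinuousAlternatingMap.toAlternatingMap_injective
  refine Module.Basis.ext_alternating (Pi.basisFun ℝ (Fin 4)) fun I _ => ?_
  simpa [e] using h I

lemma alt_three_ext {a b : Alt 3}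
    (h : ∀ i j k, a ![e i, e j, e k] = b ![e i, e j, e k]) : a = b := by
  refine alt_ext fun I => ?_
  have : (fun i => e (I i)) = ![e (I 0), e (I 1), e (I 2)] := by
    ext i : 1; fin_cases i <;> rfl
  rw [this]
  exact h _ _ _

lemma Form.ext_eval {k : ℕ} {a b : Form k}
    (h : ∀ I : Fin k → Fin 4, Form.eval (fun i => e (I i)) a = Form.eval (fun i => e (I i)) b) :
    a = b := by
  refine Subtype.ext (funext fun q => ?_)
  exact alt_ext fun I => congrFun (congrArg Subtype.val (h I)) q

lemma Form.ext_coeff3 {a b : Form 3} (h : ∀ i j k, coeff3 a i j k = coeff3 b i j k) : a = b := by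
  refine Form.ext_eval fun I => ?_
  have : (fun i => e (I i)) = ![e (I 0), e (I 1), e (I 2)] := by
    ext i : 1; fin_cases i <;> rfl
  rw [this]
  exact h _ _ _

lemma alt_eq_zero_of_lt {k : ℕ} (hk : 4 < k) (a : Alt k) : a = 0 := by
  ext v
  refine a.toAlternatingMap.map_linearDependent v fun h => ?_
  have := h.fintype_card_le_finrank
  simp at this
  omega

lemma form_eq_zero_of_lt {k : ℕ} (hk : 4 < k) (a : Form k) : a = 0 :=
  Subtype.ext (funext fun q => alt_eq_zero_of_lt hk (a.1 q))

/-! ### Wedge products in low degree -/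

lemma decomposeFin_symm_apply_two {n : ℕ} (σ : Equiv.Perm (Fin (n + 2))) (p : Fin (n + 3)) :
    Equiv.Perm.decomposeFin.symm (p, σ) 2 = Equiv.swap 0 p (σ 1).succ :=
  Equiv.Perm.decomposeFin_symm_apply_succ σ p 1

lemma decomposeFin_symm_apply_three {n : ℕ} (σ : Equiv.Perm (Fin (n + 3))) (p : Fin (n + 4)) :
    Equiv.Perm.decomposeFin.symm (p, σ) 3 = Equiv.swap 0 p (σ 2).succ :=
  Equiv.Perm.decomposeFin_symm_apply_succ σ p 2

lemma sign_decomposeFin_symm {n : ℕ} (p : Fin (n + 1)) (σ : Equiv.Perm (Fin n)) :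
    ((Equiv.Perm.sign (Equiv.Perm.decomposeFin.symm (p, σ)) : ℤ) : ℝ)
      = (if p = 0 then 1 else -1) * ((Equiv.Perm.sign σ : ℤ) : ℝ) := by
  rw [Equiv.Perm.decomposeFin.symm_sign]
  split_ifs <;> simp

lemma sum_perm_two (F : Fin 2 → Fin 2 → ℝ) :
    ∑ σ : Equiv.Perm (Fin 2), ((Equiv.Perm.sign σ : ℤ) : ℝ) * F (σ 0) (σ 1)
      = F 0 1 - F 1 0 := by
  rw [← Equiv.sum_comp Equiv.Perm.decomposeFin.symm, Fintype.sum_prod_type]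
  simp [Fin.sum_univ_succ, Equiv.Perm.decomposeFin.symm_sign]
  ring

/-- `decomposeFin` splits off the image `p` of `0`, which reduces the sum to permutations of one
letter fewer; `swap 0 p` contributes the sign `-1` unless `p = 0`. The four-letter sum repeats the
reduction. -/
lemma sum_perm_three (F : Fin 3 → Fin 3 → Fin 3 → ℝ) :
    ∑ σ : Equiv.Perm (Fin 3), ((Equiv.Perm.sign σ : ℤ) : ℝ) * F (σ 0) (σ 1) (σ 2)
      = F 0 1 2 - F 0 2 1 - F 1 0 2 + F 1 2 0 + F 2 0 1 - F 2 1 0 := by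
  have h (p : Fin 3) := sum_perm_two fun i j =>
    F p (Equiv.swap 0 p i.succ) (Equiv.swap 0 p j.succ)
  rw [← Equiv.sum_comp Equiv.Perm.decomposeFin.symm, Fintype.sum_prod_type]
  simp only [sign_decomposeFin_symm, Equiv.Perm.decomposeFin_symm_apply_zero,
    Equiv.Perm.decomposeFin_symm_apply_one,
    decomposeFin_symm_apply_two, mul_assoc, ← Finset.mul_sum, h]
  simp [Fin.sum_univ_succ, Equiv.swap_apply_def]
  ring

lemma sum_perm_four (F : Fin 4 → Fin 4 → Fin 4 → Fin 4 → ℝ) :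
    ∑ σ : Equiv.Perm (Fin 4), ((Equiv.Perm.sign σ : ℤ) : ℝ) * F (σ 0) (σ 1) (σ 2) (σ 3)
      = F 0 1 2 3 - F 0 1 3 2 - F 0 2 1 3 + F 0 2 3 1 + F 0 3 1 2 - F 0 3 2 1
      - F 1 0 2 3 + F 1 0 3 2 + F 1 2 0 3 - F 1 2 3 0 - F 1 3 0 2 + F 1 3 2 0
      + F 2 0 1 3 - F 2 0 3 1 - F 2 1 0 3 + F 2 1 3 0 + F 2 3 0 1 - F 2 3 1 0
      - F 3 0 1 2 + F 3 0 2 1 + F 3 1 0 2 - F 3 1 2 0 - F 3 2 0 1 + F 3 2 1 0 := by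
  have h (p : Fin 4) := sum_perm_three fun i j k =>
    F p (Equiv.swap 0 p i.succ) (Equiv.swap 0 p j.succ) (Equiv.swap 0 p k.succ)
  rw [← Equiv.sum_comp Equiv.Perm.decomposeFin.symm, Fintype.sum_prod_type]
  simp only [sign_decomposeFin_symm, Equiv.Perm.decomposeFin_symm_apply_zero,
    Equiv.Perm.decomposeFin_symm_apply_one,
    decomposeFin_symm_apply_two, decomposeFin_symm_apply_three, mul_assoc, ← Finset.mul_sum, h]
  simp [Fin.sum_univ_succ, Equiv.swap_apply_def]
  ring

lemma alt_two_swap (a : Alt 2) (u v : V) : a ![u, v] = -a ![v, u] := by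
  have h := a.toAlternatingMap.map_swap ![v, u] (show (0 : Fin 2) ≠ 1 by decide)
  have h' : ![v, u] ∘ Equiv.swap (0 : Fin 2) 1 = ![u, v] := by
    ext i : 1; fin_cases i <;> simp
  rw [h'] at h
  exact h

lemma alt_three_swap_left (a : Alt 3) (u v w : V) : a ![u, v, w] = -a ![v, u, w] := by
  have h := a.toAlternatingMap.map_swap ![v, u, w] (show (0 : Fin 3) ≠ 1 by decide)
  have h' : ![v, u, w] ∘ Equiv.swap (0 : Fin 3) 1 = ![u, v, w] := by
    ext i : 1; fin_cases i <;> simp [Equiv.swap_apply_def]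
  rw [h'] at h
  exact h

lemma alt_four_swap_left (a : Alt 4) (u v w x : V) : a ![u, v, w, x] = -a ![v, u, w, x] := by
  have h := a.toAlternatingMap.map_swap ![v, u, w, x] (show (0 : Fin 4) ≠ 1 by decide)
  have h' : ![v, u, w, x] ∘ Equiv.swap (0 : Fin 4) 1 = ![u, v, w, x] := by
    ext i : 1; fin_cases i <;> simp [Equiv.swap_apply_def]
  rw [h'] at h
  exact h

lemma wedgeAlt_one_one (h : 1 + 1 = 2) (α β : Alt 1) (u v : V) :
    wedgeAlt h α β ![u, v] = α ![u] * β ![v] - α ![v] * β ![u] := by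
  have h1 (σ : Equiv.Perm (Fin 2)) :
      (fun i => (![u, v] : Fin 2 → V) (σ (Fin.cast h (Fin.castAdd 1 i)))) = ![![u, v] (σ 0)] := by
    ext i : 1; fin_cases i; rfl
  have h2 (σ : Equiv.Perm (Fin 2)) :
      (fun i => (![u, v] : Fin 2 → V) (σ (Fin.cast h (Fin.natAdd 1 i)))) = ![![u, v] (σ 1)] := by
    ext i : 1; fin_cases i; rfl
  simp only [wedgeAlt_apply, h1, h2]
  rw [sum_perm_two fun i j => α ![![u, v] i] * β ![![u, v] j]]
  simp

lemma wedgeAlt_one_two (h : 1 + 2 = 3) (α : Alt 1) (β : Alt 2) (u v w : V) :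
    wedgeAlt h α β ![u, v, w]
      = α ![u] * β ![v, w] - α ![v] * β ![u, w] + α ![w] * β ![u, v] := by
  have h1 (σ : Equiv.Perm (Fin 3)) :
      (fun i => (![u, v, w] : Fin 3 → V) (σ (Fin.cast h (Fin.castAdd 2 i))))
        = ![![u, v, w] (σ 0)] := by
    ext i : 1; fin_cases i; rfl
  have h2 (σ : Equiv.Perm (Fin 3)) :
      (fun i => (![u, v, w] : Fin 3 → V) (σ (Fin.cast h (Fin.natAdd 1 i))))
        = ![![u, v, w] (σ 1), ![u, v, w] (σ 2)] := by
    ext i : 1; fin_cases i <;> rfl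
  simp only [wedgeAlt_apply, h1, h2]
  rw [sum_perm_three fun i j k => α ![![u, v, w] i] * β ![![u, v, w] j, ![u, v, w] k]]
  simp [Nat.factorial]
  rw [alt_two_swap β w v, alt_two_swap β w u, alt_two_swap β v u]
  ring

lemma wedgeAlt_two_one (h : 2 + 1 = 3) (α : Alt 2) (β : Alt 1) (u v w : V) :
    wedgeAlt h α β ![u, v, w]
      = β ![u] * α ![v, w] - β ![v] * α ![u, w] + β ![w] * α ![u, v] := by
  have h1 (σ : Equiv.Perm (Fin 3)) :
      (fun i => (![u, v, w] : Fin 3 → V) (σ (Fin.cast h (Fin.castAdd 1 i))))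
        = ![![u, v, w] (σ 0), ![u, v, w] (σ 1)] := by
    ext i : 1; fin_cases i <;> rfl
  have h2 (σ : Equiv.Perm (Fin 3)) :
      (fun i => (![u, v, w] : Fin 3 → V) (σ (Fin.cast h (Fin.natAdd 2 i))))
        = ![![u, v, w] (σ 2)] := by
    ext i : 1; fin_cases i; rfl
  simp only [wedgeAlt_apply, h1, h2]
  rw [sum_perm_three fun i j k => α ![![u, v, w] i, ![u, v, w] j] * β ![![u, v, w] k]]
  simp [Nat.factorial]
  rw [alt_two_swap α w v, alt_two_swap α w u, alt_two_swap α v u]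
  ring

lemma wedgeAlt_two_two (h : 2 + 2 = 4) (α β : Alt 2) (u v w x : V) :
    wedgeAlt h α β ![u, v, w, x]
      = α ![u, v] * β ![w, x] - α ![u, w] * β ![v, x] + α ![u, x] * β ![v, w]
        + α ![v, w] * β ![u, x] - α ![v, x] * β ![u, w] + α ![w, x] * β ![u, v] := by
  have h1 (σ : Equiv.Perm (Fin 4)) :
      (fun i => (![u, v, w, x] : Fin 4 → V) (σ (Fin.cast h (Fin.castAdd 2 i))))
        = ![![u, v, w, x] (σ 0), ![u, v, w, x] (σ 1)] := by
    ext i : 1; fin_cases i <;> rfl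
  have h2 (σ : Equiv.Perm (Fin 4)) :
      (fun i => (![u, v, w, x] : Fin 4 → V) (σ (Fin.cast h (Fin.natAdd 2 i))))
        = ![![u, v, w, x] (σ 2), ![u, v, w, x] (σ 3)] := by
    ext i : 1; fin_cases i <;> rfl
  simp only [wedgeAlt_apply, h1, h2]
  rw [sum_perm_four fun i j k l =>
    α ![![u, v, w, x] i, ![u, v, w, x] j] * β ![![u, v, w, x] k, ![u, v, w, x] l]]
  simp [Nat.factorial]
  rw [alt_two_swap α v u, alt_two_swap α w u, alt_two_swap α x u, alt_two_swap α w v,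
    alt_two_swap α x v, alt_two_swap α x w, alt_two_swap β v u, alt_two_swap β w u,
    alt_two_swap β x u, alt_two_swap β w v, alt_two_swap β x v, alt_two_swap β x w]
  ring

/-! ### Partial derivatives -/

lemma pderiv_apply_proj (l : Fin 4) (f : smoothFun) (x : V) :
    (pderiv l f).1 (proj x) = fderiv ℝ (fun z => f.1 (proj z)) x (e l) := by
  change fderiv ℝ (fun z => f.1 (proj z)) (lift (proj x)) (e l) = _
  rw [fderiv_proj]

lemma smoothFun_differentiableAt (f : smoothFun) (x : V) :
    DifferentiableAt ℝ (fun z => f.1 (proj z)) x :=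
  (ContDiff.differentiable (n := ∞) f.2 (by simp)).differentiableAt

lemma smoothFun_ext {f g : smoothFun} (h : ∀ x : V, f.1 (proj x) = g.1 (proj x)) : f = g := by
  refine Subtype.ext (funext fun q => ?_)
  obtain ⟨x, rfl⟩ := proj_surjective q
  exact h x

/-- `∂/∂θ_l` as a derivation of `C^∞(T⁴)`. -/
def pder (l : Fin 4) : Derivation ℝ smoothFun smoothFun :=
  Derivation.mk'
    { toFun := pderiv l
      map_add' := fun f g => smoothFun_ext fun x => by
        change _ = (pderiv l f).1 (proj x) + (pderiv l g).1 (proj x)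
        simp only [pderiv_apply_proj]
        exact congrArg (fun L : V →L[ℝ] ℝ => L (e l))
          (fderiv_add (smoothFun_differentiableAt f x) (smoothFun_differentiableAt g x))
      map_smul' := fun c f => smoothFun_ext fun x => by
        change _ = c * (pderiv l f).1 (proj x)
        simp only [pderiv_apply_proj]
        exact congrArg (fun L : V →L[ℝ] ℝ => L (e l))
          (fderiv_const_smul (smoothFun_differentiableAt f x) c) }
    fun f g => smoothFun_ext fun x => by
      change (pderiv l (f * g)).1 (proj x) = f.1 (proj x) * (pderiv l g).1 (proj x)
        + g.1 (proj x) * (pderiv l f).1 (proj x)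
      simp only [pderiv_apply_proj]
      exact congrArg (fun L : V →L[ℝ] ℝ => L (e l))
        (fderiv_mul (smoothFun_differentiableAt f x) (smoothFun_differentiableAt g x))

lemma pder_apply_proj (l : Fin 4) (f : smoothFun) (x : V) :
    (pder l f).1 (proj x) = fderiv ℝ (fun z => f.1 (proj z)) x (e l) :=
  pderiv_apply_proj l f x

/-! ### Coefficients of the operations on forms -/

lemma coeff1_d (f : Form 0) (i : Fin 4) : coeff1 (d f) i = pder i (Form.eval ![] f) := by
  refine smoothFun_ext fun x => ?_
  rw [pder_apply_proj, Form.eval_apply, d_apply_proj,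
    extDeriv_apply (f.smooth.differentiable (by simp)).differentiableAt]
  simp [Form.eval_apply]

lemma coeff2_d (om : Form 1) (i j : Fin 4) :
    coeff2 (d om) i j = pder i (coeff1 om j) - pder j (coeff1 om i) := by
  refine smoothFun_ext fun x => ?_
  change _ = (pder i (coeff1 om j)).1 (proj x) - (pder j (coeff1 om i)).1 (proj x)
  rw [pder_apply_proj, pder_apply_proj, Form.eval_apply, d_apply_proj,
    extDeriv_apply (om.smooth.differentiable (by simp)).differentiableAt]
  have h0 : (0 : Fin 2).removeNth ![e i, e j] = ![e j] := by ext k : 1; fin_cases k; rfl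
  have h1 : (1 : Fin 2).removeNth ![e i, e j] = ![e i] := by ext k : 1; fin_cases k; rfl
  simp [Form.eval_apply, Fin.sum_univ_two, h0, h1, sub_eq_add_neg]

lemma coeff3_d (om : Form 2) (i j k : Fin 4) :
    coeff3 (d om) i j k
      = pder i (coeff2 om j k) - pder j (coeff2 om i k) + pder k (coeff2 om i j) := by
  refine smoothFun_ext fun x => ?_
  change _ = (pder i (coeff2 om j k)).1 (proj x) - (pder j (coeff2 om i k)).1 (proj x)
    + (pder k (coeff2 om i j)).1 (proj x)
  rw [pder_apply_proj, pder_apply_proj, pder_apply_proj, Form.eval_apply, d_apply_proj,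
    extDeriv_apply (om.smooth.differentiable (by simp)).differentiableAt]
  have h0 : (0 : Fin 3).removeNth ![e i, e j, e k] = ![e j, e k] := by
    ext k : 1; fin_cases k <;> rfl
  have h1 : (1 : Fin 3).removeNth ![e i, e j, e k] = ![e i, e k] := by
    ext k : 1; fin_cases k <;> rfl
  have h2 : (2 : Fin 3).removeNth ![e i, e j, e k] = ![e i, e j] := by
    ext k : 1; fin_cases k <;> rfl
  simp [Form.eval_apply, Fin.sum_univ_three, h0, h1, h2, sub_eq_add_neg]

lemma coeff2_swap (om : Form 2) (i j : Fin 4) : coeff2 om i j = -coeff2 om j i :=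
  smoothFun_ext fun x => alt_two_swap (om.1 (proj x)) (e i) (e j)

lemma coeff2_self (om : Form 2) (i : Fin 4) : coeff2 om i i = 0 := by
  have h := coeff2_swap om i i
  refine smoothFun_ext fun x => ?_
  have h' := congrFun (congrArg Subtype.val h) (proj x)
  change (coeff2 om i i).1 (proj x) = -(coeff2 om i i).1 (proj x) at h'
  change (coeff2 om i i).1 (proj x) = 0
  linarith

lemma coeff2_wedge (h : 1 + 1 = 2) (α β : Form 1) (i j : Fin 4) :
    coeff2 (wedge h α β) i j = coeff1 α i * coeff1 β j - coeff1 α j * coeff1 β i :=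
  smoothFun_ext fun x => wedgeAlt_one_one h (α.1 (proj x)) (β.1 (proj x)) (e i) (e j)

lemma coeff3_wedge_one_two (h : 1 + 2 = 3) (α : Form 1) (β : Form 2) (i j k : Fin 4) :
    coeff3 (wedge h α β) i j k
      = coeff1 α i * coeff2 β j k - coeff1 α j * coeff2 β i k + coeff1 α k * coeff2 β i j :=
  smoothFun_ext fun x => wedgeAlt_one_two h (α.1 (proj x)) (β.1 (proj x)) (e i) (e j) (e k)

lemma coeff3_wedge_two_one (h : 2 + 1 = 3) (α : Form 2) (β : Form 1) (i j k : Fin 4) :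
    coeff3 (wedge h α β) i j k
      = coeff1 β i * coeff2 α j k - coeff1 β j * coeff2 α i k + coeff1 β k * coeff2 α i j :=
  smoothFun_ext fun x => wedgeAlt_two_one h (α.1 (proj x)) (β.1 (proj x)) (e i) (e j) (e k)

lemma eval_wedge_two_two (h : 2 + 2 = 4) (α β : Form 2) (i j k l : Fin 4) :
    Form.eval ![e i, e j, e k, e l] (wedge h α β)
      = coeff2 α i j * coeff2 β k l - coeff2 α i k * coeff2 β j l + coeff2 α i l * coeff2 β j k
        + coeff2 α j k * coeff2 β i l - coeff2 α j l * coeff2 β i k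
        + coeff2 α k l * coeff2 β i j :=
  smoothFun_ext fun x =>
    wedgeAlt_two_two h (α.1 (proj x)) (β.1 (proj x)) (e i) (e j) (e k) (e l)

lemma coeff1_contrVec (om : Form 2) (i j : Fin 4) :
    coeff1 (contrVec (e i) om) j = coeff2 om i j := rfl

lemma eval_contrVec {k : ℕ} (om : Form (k + 1)) (u : V) (v : Fin k → V) :
    Form.eval v (contrVec u om) = Form.eval (Matrix.vecCons u v) om := rfl

lemma eval_fmul {k : ℕ} (f : smoothFun) (om : Form k) (v : Fin k → V) :
    Form.eval v (fmul f om) = f * Form.eval v om := rfl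

/-- Of the sixteen terms only those with `π³⁴ = 1` and `π⁴³ = -1` survive. -/
lemma eval_contr_biv {k : ℕ} (om : Form (k + 2)) (v : Fin k → V) :
    Form.eval v (contr biv om) = (2⁻¹ : ℝ) •
      (Form.eval (Matrix.vecCons (e 3) (Matrix.vecCons (e 2) v)) om
        - Form.eval (Matrix.vecCons (e 2) (Matrix.vecCons (e 3) v)) om) := by
  have h23 : biv.comp 2 3 = 1 := by simp [biv]
  have h32 : biv.comp 3 2 = -1 := by simp [biv]
  have h0 : ∀ i j, ¬(i = 2 ∧ j = 3) → ¬(i = 3 ∧ j = 2) → biv.comp i j = 0 := by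
    intro i j h h'
    simp [biv, h, h']
  simp only [contr, map_smul, Fin.sum_univ_four]
  rw [h0 0 0, h0 0 1, h0 0 2, h0 0 3, h0 1 0, h0 1 1, h0 1 2, h0 1 3, h0 2 0, h0 2 1, h0 2 2,
    h0 3 0, h0 3 1, h0 3 3, h23, h32]
  · congr 1
    simp only [map_add, eval_fmul, eval_contrVec]
    ring
  all_goals decide

/-! ### The Koszul bracket of 2-forms in coordinates -/

lemma eval_contr_biv_two (om : Form 2) : Form.eval ![] (contr biv om) = coeff2 om 3 2 := by
  have h : Form.eval ![] (contr biv om) = (2⁻¹ : ℝ) • (coeff2 om 3 2 - coeff2 om 2 3) :=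
    eval_contr_biv om ![]
  rw [h, coeff2_swap om 2 3]
  module

lemma coeff1_contr_biv (om : Form 3) (i : Fin 4) :
    coeff1 (contr biv om) i = coeff3 om 3 2 i := by
  have h : coeff1 (contr biv om) i = (2⁻¹ : ℝ) • (coeff3 om 3 2 i - coeff3 om 2 3 i) :=
    eval_contr_biv om ![e i]
  have h' : coeff3 om 2 3 i = -coeff3 om 3 2 i :=
    smoothFun_ext fun x => alt_three_swap_left (om.1 (proj x)) _ _ _
  rw [h, h']
  module

lemma coeff2_contr_biv (om : Form 4) (i j : Fin 4) :
    coeff2 (contr biv om) i j = Form.eval ![e 3, e 2, e i, e j] om := by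
  have h : coeff2 (contr biv om) i j = (2⁻¹ : ℝ) •
      (Form.eval ![e 3, e 2, e i, e j] om - Form.eval ![e 2, e 3, e i, e j] om) :=
    eval_contr_biv om ![e i, e j]
  have h' : Form.eval ![e 2, e 3, e i, e j] om = -Form.eval ![e 3, e 2, e i, e j] om :=
    smoothFun_ext fun x => alt_four_swap_left (om.1 (proj x)) _ _ _ _
  rw [h, h']
  module

lemma coeff1_lieD (om : Form 2) (i : Fin 4) :
    coeff1 (lieD biv om) i = pder 3 (coeff2 om 2 i) - pder 2 (coeff2 om 3 i) := by
  have h : lieD biv om = contr biv (d om) - d (contr biv om) := rfl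
  simp only [h, map_sub]
  change coeff1 _ i - coeff1 _ i = _
  rw [coeff1_contr_biv, coeff1_d, coeff3_d, eval_contr_biv_two]
  ring

/-- The coefficients of `ι_π (α ∧ β)`. -/
def contrWedge (α β : Form 2) (i j : Fin 4) : smoothFun :=
  coeff2 α 3 2 * coeff2 β i j - coeff2 α 3 i * coeff2 β 2 j + coeff2 α 3 j * coeff2 β 2 i
    + coeff2 α 2 i * coeff2 β 3 j - coeff2 α 2 j * coeff2 β 3 i + coeff2 α i j * coeff2 β 3 2

/-- The term `ι_π d(α ∧ β)` of the Lie derivative drops out because `d(α ∧ β)` is a 5-form on a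
4-manifold. The prefactor `(-1)³` makes the remaining signs positive. -/
lemma koszul_two_two (α β : Form 2) :
    koszul biv α β = d (contr biv (wedge (n := 4) rfl α β))
      + wedge rfl (lieD biv α) β + wedge rfl α (lieD biv β) := by
  have h1 : lieD biv (wedge (n := 4) rfl α β)
      = contr biv (d (wedge (n := 4) rfl α β)) - d (contr biv (wedge (n := 4) rfl α β)) := rfl
  have h : koszul biv α β = (-1 : ℝ) ^ (1 + 1 + 1) •
    (lieD biv (wedge (n := 4) rfl α β)
      - wedge rfl (lieD biv α) β - (-1 : ℝ) ^ (1 + 1) • wedge rfl α (lieD biv β)) := by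
    unfold koszul
    congr 1
  have h0 : contr biv (d (wedge (n := 4) rfl α β)) = 0 := by
    rw [form_eq_zero_of_lt (by norm_num) (d (wedge (n := 4) rfl α β))]
    refine Form.ext_coeff3 fun i j k => ?_
    have h : coeff3 (contr biv (0 : Form 5)) i j k = _ := eval_contr_biv _ ![e i, e j, e k]
    rw [h]
    simp
  rw [h, h1, h0]
  module

lemma coeff3_koszul (α β : Form 2) (i j k : Fin 4) :
    coeff3 (koszul biv α β) i j k
      = pder i (contrWedge α β j k) - pder j (contrWedge α β i k) + pder k (contrWedge α β i j)
        + ((pder 3 (coeff2 α 2 i) - pder 2 (coeff2 α 3 i)) * coeff2 β j k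
          - (pder 3 (coeff2 α 2 j) - pder 2 (coeff2 α 3 j)) * coeff2 β i k
          + (pder 3 (coeff2 α 2 k) - pder 2 (coeff2 α 3 k)) * coeff2 β i j)
        + ((pder 3 (coeff2 β 2 i) - pder 2 (coeff2 β 3 i)) * coeff2 α j k
          - (pder 3 (coeff2 β 2 j) - pder 2 (coeff2 β 3 j)) * coeff2 α i k
          + (pder 3 (coeff2 β 2 k) - pder 2 (coeff2 β 3 k)) * coeff2 α i j) := by
  have hc : ∀ i j, coeff2 (contr biv (wedge (n := 4) rfl α β)) i j = contrWedge α β i j :=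
    fun i j => (coeff2_contr_biv _ i j).trans (eval_wedge_two_two rfl α β 3 2 i j)
  have h1 : coeff3 (koszul biv α β) i j k = coeff3 (d (contr biv (wedge (n := 4) rfl α β))) i j k
      + coeff3 (wedge rfl (lieD biv α) β) i j k + coeff3 (wedge rfl α (lieD biv β)) i j k := by
    rw [koszul_two_two]
    simp only [map_add]
  rw [h1, coeff3_d, coeff3_wedge_one_two, coeff3_wedge_two_one]
  simp only [hc, coeff1_lieD]

lemma lam2_eq_koszul (α β : Form 2) : lam2 biv α β = koszul biv α β := by
  have h : lam2 biv α β = (-1 : ℝ) ^ (1 + 1) • koszul biv α β := rfl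
  rw [h]
  norm_num

lemma lam2_zero_left (β : Form 2) : lam2 biv (0 : Form 2) β = 0 := by
  rw [lam2_eq_koszul]
  refine Form.ext_coeff3 fun i j k => ?_
  rw [coeff3_koszul]
  simp [contrWedge]

lemma lam2_zero_right (α : Form 2) : lam2 biv α (0 : Form 2) = 0 := by
  rw [lam2_eq_koszul]
  refine Form.ext_coeff3 fun i j k => ?_
  rw [coeff3_koszul]
  simp [contrWedge]

/-- Every term of the Schouten bracket differentiates a component of `π`, and these are constant. -/
lemma lam3_biv {r s t : ℕ} (α : Form (r + 1)) (β : Form (s + 1)) (γ : Form (t + 1)) :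
    lam3 biv α β γ = 0 := by
  have h0 : ∀ (l i j : Fin 4), pderiv l (biv.comp i j) = 0 := fun l i j =>
    (pder l).map_algebraMap _
  have h1 : ∀ i j k, biv.halfSchouten i j k = 0 := fun i j k => by
    simp [Bivector.halfSchouten, h0]
  have h2 : ∀ {k : ℕ} (om : Form k), fmul 0 om = 0 := fun om =>
    Form.ext_eval fun I => by rw [eval_fmul, zero_mul, map_zero]
  simp [lam3, koszul3, h1, h2]

/-- The 2-form `2 (ι_{∂₃} w) ∧ (ι_{∂₄} w)`, a primitive of `λ₂(w, w)` for closed `w`. -/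
def primitive (w : Form 2) : Form 2 :=
  (2 : ℝ) • wedge rfl (contrVec (e 2) w) (contrVec (e 3) w)

lemma coeff2_primitive (w : Form 2) (i j : Fin 4) :
    coeff2 (primitive w) i j
      = 2 * (coeff2 w 2 i * coeff2 w 3 j - coeff2 w 2 j * coeff2 w 3 i) := by
  simp only [primitive, map_smul]
  change (2 : ℝ) • coeff2 _ i j = _
  rw [coeff2_wedge]
  simp only [coeff1_contrVec]
  rw [Algebra.smul_def, map_ofNat]

lemma closed_coeff {w : Form 2} (hw : d w = 0) (i j k : Fin 4) :
    pder i (coeff2 w j k) - pder j (coeff2 w i k) + pder k (coeff2 w i j) = 0 := by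
  rw [← coeff3_d, hw]
  exact map_zero _

/-- Contracting gives `ι_π(w ∧ w) = 2(ι_π w)w + 2 ι_{∂₃}w ∧ ι_{∂₄}w`, and closedness gives `L_π w =
-d(ι_π w)`. In `[w,w] = d ι_π(w ∧ w) + 2 L_π w ∧ w` the terms `d(ι_π w) ∧ w` cancel. In the final
combination `h1`, `h2`, `h3` express `L_π w = -d(ι_π w)`, and `h4` removes `(ι_π w) dw`. -/
lemma d_primitive {w : Form 2} (hw : d w = 0) : d (primitive w) = lam2 biv w w := by
  rw [lam2_eq_koszul]
  refine Form.ext_coeff3 fun i j k => ?_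
  rw [coeff3_koszul, coeff3_d]
  have h1 := closed_coeff hw 3 2 i
  have h2 := closed_coeff hw 3 2 j
  have h3 := closed_coeff hw 3 2 k
  have h4 := closed_coeff hw i j k
  have two : ∀ l, pder l (2 : smoothFun) = 0 := fun l => mod_cast (pder l).map_natCast 2
  simp only [coeff2_primitive, contrWedge, map_add, map_sub, Derivation.leibniz, two, smul_eq_mul]
  linear_combination (-2 * coeff2 w j k) * h1 + (2 * coeff2 w i k) * h2
    - (2 * coeff2 w i j) * h3 - 2 * coeff2 w 3 2 * h4

/-! ### The pre-symplectic form `dθ₃ ∧ dθ₄` -/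

lemma e_apply (i j : Fin 4) : e i j = if j = i then 1 else 0 := Pi.single_apply i 1 j

lemma dθ_apply (i : Fin 4) (u : V) : dθ i ![u] = u i := rfl

lemma dθ2_apply (i j : Fin 4) (u v : V) : dθ2 i j ![u, v] = u i * v j - v i * u j :=
  wedgeAlt_one_one rfl (dθ i) (dθ j) u v

lemma dθ3_apply (i j k : Fin 4) (u v w : V) :
    dθ3 i j k ![u, v, w] = u k * (v i * w j - w i * v j) - v k * (u i * w j - w i * u j)
      + w k * (u i * v j - v i * u j) := by
  have h : dθ3 i j k ![u, v, w] = _ := wedgeAlt_two_one rfl (dθ2 i j) (dθ k) u v w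
  rw [h]
  simp only [dθ2_apply, dθ_apply]

lemma flat_eta_apply (q : T4) (v w : V) : flat eta q v w = v 2 * w 3 - w 2 * v 3 := by
  rw [flat_apply]
  exact dθ2_apply 2 3 v w

lemma mem_span_e01 (v : V) : v ∈ Submodule.span ℝ {e 0, e 1} ↔ v 2 = 0 ∧ v 3 = 0 := by
  rw [Submodule.mem_span_pair]
  constructor
  · rintro ⟨a, b, rfl⟩
    simp [e_apply]
  · rintro ⟨h2, h3⟩
    refine ⟨v 0, v 1, ?_⟩
    ext i
    fin_cases i <;> simp [e_apply, h2, h3]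

lemma mem_G34 (q : T4) (v : V) : v ∈ G34 q ↔ v 0 = 0 ∧ v 1 = 0 := by
  rw [G34, Submodule.mem_span_pair]
  constructor
  · rintro ⟨a, b, rfl⟩
    simp [e_apply]
  · rintro ⟨h2, h3⟩
    refine ⟨v 2, v 3, ?_⟩
    ext i
    fin_cases i <;> simp [e_apply, h2, h3]

lemma kerAt_eta (q : T4) : kerAt eta q = Submodule.span ℝ {e 0, e 1} := by
  ext v
  rw [mem_span_e01, kerAt, LinearMap.mem_ker]
  constructor
  · intro h
    have h2 := congrArg (fun L : V →L[ℝ] ℝ => L (e 3)) h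
    have h3 := congrArg (fun L : V →L[ℝ] ℝ => L (e 2)) h
    simp only [flat_eta_apply] at h2 h3
    simp [e_apply] at h2 h3
    exact ⟨h2, h3⟩
  · rintro ⟨h2, h3⟩
    ext w
    rw [flat_eta_apply, h2, h3]
    simp

lemma finrank_kerAt_eta (q : T4) : Module.finrank ℝ (kerAt eta q) = 2 := by
  have h : LinearIndependent ℝ ![e 0, e 1] := by
    refine LinearIndependent.pair_iff.2 fun a b hab => ?_
    have h0 := congrFun hab 0
    have h1 := congrFun hab 1
    simp [e_apply] at h0 h1
    exact ⟨h0, h1⟩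
  have := finrank_span_eq_card h
  rw [Matrix.range_cons_cons_empty] at this
  rw [kerAt_eta]
  simpa using this

lemma coeff2_eta (i j : Fin 4) :
    coeff2 eta i j = algebraMap ℝ smoothFun (dθ2 2 3 ![e i, e j]) := rfl

lemma d_eta : d eta = 0 := by
  refine Form.ext_coeff3 fun i j k => ?_
  rw [coeff3_d]
  simp only [coeff2_eta, Derivation.map_algebraMap]
  simp

lemma isPreSymplectic_eta : IsPreSymplectic 2 eta := by
  refine ⟨d_eta, fun q => ?_⟩
  have h := LinearMap.finrank_range_add_finrank_ker (flat eta q)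
  have h' := finrank_kerAt_eta q
  rw [kerAt] at h'
  rw [h'] at h
  simpa using h

lemma biv_sharp (q : T4) (ξ : V →L[ℝ] ℝ) :
    biv.sharp q ξ = ξ (e 2) • e 3 - ξ (e 3) • e 2 := by
  have hc : ∀ i j, (biv.comp i j).1 q
      = (if i = 2 ∧ j = 3 then 1 else 0) - (if i = 3 ∧ j = 2 then 1 else 0) := fun _ _ => rfl
  change ∑ i, ∑ j, ((biv.comp i j).1 q * ξ (e i)) • e j = _
  simp [Fin.sum_univ_four, hc, sub_eq_add_neg]

lemma isNegInverse_biv : IsNegInverse eta G34 biv := by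
  intro q
  refine ⟨⟨?_, ?_⟩, ?_, ?_⟩
  · rw [Submodule.disjoint_def, kerAt_eta]
    intro v h h'
    rw [mem_span_e01] at h
    rw [mem_G34] at h'
    ext i
    fin_cases i
    exacts [h'.1, h'.2, h.1, h.2]
  · rw [codisjoint_iff, eq_top_iff, kerAt_eta]
    intro v _
    rw [Submodule.mem_sup]
    refine ⟨v 0 • e 0 + v 1 • e 1, ?_, v 2 • e 2 + v 3 • e 3, ?_, ?_⟩
    · rw [mem_span_e01]
      simp [e_apply]
    · rw [mem_G34]
      simp [e_apply]
    · ext i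
      fin_cases i <;> simp [e_apply]
  · rintro _ ⟨ξ, rfl⟩
    rw [biv_sharp, mem_G34]
    simp [e_apply]
  · intro v hv
    rw [mem_G34] at hv
    rw [biv_sharp, flat_eta_apply, flat_eta_apply]
    ext i
    fin_cases i <;> simp [e_apply, hv.1, hv.2]

/-! ### Horizontal forms -/

lemma e_mem_kerAt_eta {q : T4} {i : Fin 4} (hi : i = 0 ∨ i = 1) : e i ∈ kerAt eta q := by
  rw [kerAt_eta, mem_span_e01]
  rcases hi with rfl | rfl <;> simp [e_apply]

lemma coeff1_eq_zero_of_hor {α : Form 1} (hα : α ∈ horForm eta 1) {i : Fin 4}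
    (hi : i = 0 ∨ i = 1) : coeff1 α i = 0 := by
  refine smoothFun_ext fun x => hα (proj x) ![e i] fun j => ?_
  fin_cases j
  exact e_mem_kerAt_eta hi

/-- `K` is a plane with basis `∂₁`, `∂₂`, so by bilinearity and skew-symmetry one coefficient
decides. -/
lemma mem_horForm_two {w : Form 2} : w ∈ horForm eta 2 ↔ coeff2 w 0 1 = 0 := by
  constructor
  · intro hw
    refine smoothFun_ext fun x => hw (proj x) ![e 0, e 1] fun j => ?_
    fin_cases j
    · exact e_mem_kerAt_eta (Or.inl rfl)
    · exact e_mem_kerAt_eta (Or.inr rfl)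
  · intro h q v hv
    have h01 : flat w q (e 0) (e 1) = 0 := by
      rw [flat_apply]
      exact congrFun (congrArg Subtype.val h) q
    have hswap : ∀ u v, flat w q u v = -flat w q v u := fun u v => by
      rw [flat_apply, flat_apply]
      exact alt_two_swap _ _ _
    have h10 := hswap (e 1) (e 0)
    have h00 := hswap (e 0) (e 0)
    have h11 := hswap (e 1) (e 1)
    have h00' : flat w q (e 0) (e 0) = 0 := by linarith
    have h11' : flat w q (e 1) (e 1) = 0 := by linarith
    have hv0 := hv 0
    have hv1 := hv 1
    rw [kerAt_eta, Submodule.mem_span_pair] at hv0 hv1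
    obtain ⟨a, b, hab⟩ := hv0
    obtain ⟨c, b', hcd⟩ := hv1
    have : v = ![v 0, v 1] := by ext i : 1; fin_cases i <;> rfl
    rw [this, ← flat_apply, ← hab, ← hcd]
    simp [h01, h10, h00', h11']

/-- Three vectors in the plane `K` are dependent. Horizontality therefore constrains the primitives
of `λ₂(w,w)`, not `λ₂(w,w)` itself. -/
lemma mem_horForm_three (om : Form 3) : om ∈ horForm eta 3 := by
  intro q v hv
  refine (om.1 q).toAlternatingMap.map_linearDependent v fun h => ?_
  have h' : LinearIndependent ℝ (fun i => (⟨v i, hv i⟩ : kerAt eta q)) :=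
    LinearIndependent.of_comp (kerAt eta q).subtype h
  have := h'.fintype_card_le_finrank
  rw [finrank_kerAt_eta] at this
  simp at this

lemma d_d {k : ℕ} (om : Form k) : d (d om) = 0 := by
  refine Subtype.ext (funext fun q => ?_)
  obtain ⟨x, rfl⟩ := proj_surjective q
  rw [d_apply_proj]
  have h : (fun z => (d om).1 (proj z)) = extDeriv (fun z => om.1 (proj z)) :=
    funext fun z => d_apply_proj om z
  rw [h, extDeriv_extDeriv om.smooth (by simp; exact WithTop.coe_le_coe.2 le_top)]
  rfl

/-! ### The Kuranishi map -/

lemma lam2_mem_closedHor (w : closedHor eta 2) : lam2 biv w.1 w.1 ∈ closedHor eta 3 := by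
  refine ⟨mem_horForm_three _, ?_⟩
  change d (lam2 biv w.1 w.1) = 0
  rw [← d_primitive w.2.2]
  exact d_d _

lemma coeff2_of_mem_closedHor (w : closedHor eta 2) : coeff2 w.1 0 1 = 0 :=
  mem_horForm_two.1 w.2.1

lemma cls_eq_iff {k : ℕ} {w w' : closedHor eta (k + 1)} :
    cls w = cls w' ↔ ∃ α ∈ horForm eta k, d α = w.1 - w'.1 := by
  rw [cls, cls, Submodule.Quotient.eq]
  rfl

/-- Up to a horizontal form and a differential, the primitive of `λ₂(w, w)` depends only on the
horizontal cohomology class of `w`. -/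
lemma primitive_sub_primitive_sub_d_mem {w w' : closedHor eta 2} {α : Form 1}
    (hα : α ∈ horForm eta 1) (h : d α = w'.1 - w.1) :
    ∃ γ : Form 1, primitive w'.1 - primitive w.1 - d γ ∈ horForm eta 2 := by
  -- Put `W = w + w'`. Polarisation gives `P(w') - P(w) = ι_{∂₃}dα ∧ ι_{∂₄}W + ι_{∂₃}W ∧ ι_{∂₄}dα`.
  -- Along `K`, where `α` vanishes, `ι_{∂₃}dα` and `ι_{∂₄}dα` restrict to `-dα₃` and `-dα₄`, while
  -- `ι_{∂₃}W` and `ι_{∂₄}W` are leafwise closed because `W` is closed and `W₁₂ = 0`. Hence the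
  -- difference is the leafwise differential of `α₄ ι_{∂₃}W - α₃ ι_{∂₄}W`.
  refine ⟨fmul (coeff1 α 3) (contrVec (e 2) (w.1 + w'.1))
    - fmul (coeff1 α 2) (contrVec (e 3) (w.1 + w'.1)), ?_⟩
  rw [mem_horForm_two]
  have ha0 := coeff1_eq_zero_of_hor hα (i := 0) (Or.inl rfl)
  have ha1 := coeff1_eq_zero_of_hor hα (i := 1) (Or.inr rfl)
  have hd : ∀ i j, coeff2 w'.1 i j = coeff2 w.1 i j
      + (pder i (coeff1 α j) - pder j (coeff1 α i)) := fun i j => by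
    rw [← coeff2_d, h]
    simp
  have hγ : ∀ i, coeff1 (fmul (coeff1 α 3) (contrVec (e 2) (w.1 + w'.1))
      - fmul (coeff1 α 2) (contrVec (e 3) (w.1 + w'.1))) i
      = coeff1 α 3 * (coeff2 w.1 2 i + coeff2 w'.1 2 i)
        - coeff1 α 2 * (coeff2 w.1 3 i + coeff2 w'.1 3 i) := fun i => rfl
  have hsub : ∀ a b c : Form 2, coeff2 (a - b - c) 0 1 = coeff2 a 0 1 - coeff2 b 0 1 - coeff2 c 0 1 :=
    fun a b c => rfl
  rw [hsub, coeff2_primitive, coeff2_primitive, coeff2_d, hγ, hγ]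
  have h1 := closed_coeff w.2.2 0 2 1
  have h2 := closed_coeff w.2.2 0 3 1
  have h3 := closed_coeff w'.2.2 0 2 1
  have h4 := closed_coeff w'.2.2 0 3 1
  rw [coeff2_of_mem_closedHor, coeff2_swap _ 0 2] at h1 h3
  rw [coeff2_of_mem_closedHor, coeff2_swap _ 0 3] at h2 h4
  simp only [map_add, map_sub, map_neg, map_zero, Derivation.leibniz, smul_eq_mul] at h1 h2 h3 h4 ⊢
  have e20 := hd 2 0
  have e31 := hd 3 1
  have e21 := hd 2 1
  have e30 := hd 3 0
  rw [ha0, map_zero] at e20 e30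
  rw [ha1, map_zero] at e31 e21
  linear_combination (coeff2 w.1 3 1 + coeff2 w'.1 3 1) * e20
    + (coeff2 w.1 2 0 + coeff2 w'.1 2 0) * e31 - (coeff2 w.1 3 0 + coeff2 w'.1 3 0) * e21
    - (coeff2 w.1 2 1 + coeff2 w'.1 2 1) * e30
    - coeff1 α 3 * (h1 + h3) + coeff1 α 2 * (h2 + h4)

/-- The Kuranishi map `[w] ↦ [λ₂(w, w)]`. -/
def kuranishi (c : HHor eta 1) : HHor eta 2 :=
  cls ⟨_, lam2_mem_closedHor (Function.surjInv (Submodule.Quotient.mk_surjective _) c)⟩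

/-- The representative picked by `surjInv` differs from `w` by some `dα` with `α` horizontal; the
horizontal form `P(w') - P(w) - dγ` is then a primitive of the difference of the brackets. -/
lemma kuranishi_cls (w : closedHor eta 2) :
    kuranishi (cls w) = cls ⟨lam2 biv w.1 w.1, lam2_mem_closedHor w⟩ := by
  set w' := Function.surjInv (Submodule.Quotient.mk_surjective _) (cls w) with hw'
  have h : cls w' = cls w := Function.surjInv_eq _ _
  obtain ⟨α, hα, h⟩ := cls_eq_iff.1 h
  obtain ⟨γ, hγ⟩ := primitive_sub_primitive_sub_d_mem hα h
  refine cls_eq_iff.2 ⟨_, hγ, ?_⟩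
  rw [map_sub, map_sub, d_d, d_primitive w.2.2, d_primitive w'.2.2, sub_zero]

/-! ### Integration over the leaves of `K` -/

/-- The point `(p₁, p₂, s, u)` of `ℝ⁴`. -/
def leafPoint (s u : ℝ) (p : ℝ × ℝ) : V := p.1 • e 0 + p.2 • e 1 + (s • e 2 + u • e 3)

/-- The fundamental domain `[0, 2π]²` of a leaf of `K`. -/
def leafBox : Set (ℝ × ℝ) := Set.Icc (0, 0) (2 * Real.pi, 2 * Real.pi)

/-- The integral of a function over the leaf `θ₃ = s`, `θ₄ = u`. -/
def leafIntegral (f : smoothFun) (s u : ℝ) : ℝ :=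
  ∫ p in leafBox, f.1 (proj (leafPoint s u p))

lemma leafPoint_apply (s u : ℝ) (p : ℝ × ℝ) : leafPoint s u p = ![p.1, p.2, s, u] := by
  ext i
  fin_cases i <;> simp [leafPoint, e_apply]

lemma continuous_smoothFun (f : smoothFun) : Continuous fun x : V => f.1 (proj x) :=
  ContDiff.continuous (n := ∞) f.2

lemma continuous_leaf (f : smoothFun) (u : ℝ) :
    Continuous fun z : (ℝ × ℝ) × ℝ => f.1 (proj (leafPoint z.2 u z.1)) := by
  refine (continuous_smoothFun f).comp ?_
  unfold leafPoint
  fun_prop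

lemma continuous_leaf_fixed (f : smoothFun) (s u : ℝ) :
    Continuous fun p : ℝ × ℝ => f.1 (proj (leafPoint s u p)) :=
  (continuous_leaf f u).comp (by fun_prop : Continuous fun p : ℝ × ℝ => (p, s))

lemma isCompact_leafBox : IsCompact leafBox := isCompact_Icc

lemma hasFDerivAt_leaf (f : smoothFun) (s u : ℝ) (p : ℝ × ℝ) :
    HasFDerivAt (fun p => f.1 (proj (leafPoint s u p)))
      ((fderiv ℝ (fun z => f.1 (proj z)) (leafPoint s u p)).comp
        ((ContinuousLinearMap.fst ℝ ℝ ℝ).smulRight (e 0)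
          + (ContinuousLinearMap.snd ℝ ℝ ℝ).smulRight (e 1))) p := by
  refine (smoothFun_differentiableAt f _).hasFDerivAt.comp p ?_
  exact ((ContinuousLinearMap.fst ℝ ℝ ℝ).smulRight (e 0)
    + (ContinuousLinearMap.snd ℝ ℝ ℝ).smulRight (e 1)).hasFDerivAt.add_const _

lemma proj_leafPoint_right (s u x : ℝ) :
    proj (leafPoint s u (2 * Real.pi, x)) = proj (leafPoint s u (0, x)) := by
  rw [leafPoint_apply, leafPoint_apply]
  funext i
  fin_cases i
  · exact AddCircle.coe_period _
  all_goals rfl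

lemma proj_leafPoint_top (s u x : ℝ) :
    proj (leafPoint s u (x, 2 * Real.pi)) = proj (leafPoint s u (x, 0)) := by
  rw [leafPoint_apply, leafPoint_apply]
  funext i
  fin_cases i
  · rfl
  · exact AddCircle.coe_period _
  all_goals rfl

/-- This is the divergence theorem on the square; opposite edges have the same image in `T⁴`, so the
boundary terms cancel. -/
lemma leafIntegral_divergence (p q : smoothFun) (s u : ℝ) :
    leafIntegral (pder 0 p + pder 1 q) s u = 0 := by
  have hv : ∀ (f : smoothFun) (z : ℝ × ℝ), ((fderiv ℝ (fun z => f.1 (proj z)) (leafPoint s u z)).comp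
        ((ContinuousLinearMap.fst ℝ ℝ ℝ).smulRight (e 0)
          + (ContinuousLinearMap.snd ℝ ℝ ℝ).smulRight (e 1))) (1, 0)
      = (pder 0 f).1 (proj (leafPoint s u z)) := fun f z => by
    rw [pder_apply_proj]; simp
  have hv' : ∀ (f : smoothFun) (z : ℝ × ℝ), ((fderiv ℝ (fun z => f.1 (proj z)) (leafPoint s u z)).comp
        ((ContinuousLinearMap.fst ℝ ℝ ℝ).smulRight (e 0)
          + (ContinuousLinearMap.snd ℝ ℝ ℝ).smulRight (e 1))) (0, 1)
      = (pder 1 f).1 (proj (leafPoint s u z)) := fun f z => by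
    rw [pder_apply_proj]; simp
  have hπ : (0 : ℝ) ≤ 2 * Real.pi := by positivity
  have h := MeasureTheory.integral_divergence_prod_Icc_of_hasFDerivAt_of_le
    (fun z => p.1 (proj (leafPoint s u z))) (fun z => q.1 (proj (leafPoint s u z))) _ _
    (0, 0) (2 * Real.pi, 2 * Real.pi) ⟨hπ, hπ⟩
    (continuous_leaf_fixed p s u).continuousOn (continuous_leaf_fixed q s u).continuousOn
    (fun z _ => hasFDerivAt_leaf p s u z) (fun z _ => hasFDerivAt_leaf q s u z) (by
      simp only [hv, hv']
      exact ((continuous_leaf_fixed (pder 0 p) s u).add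
        (continuous_leaf_fixed (pder 1 q) s u)).continuousOn.integrableOn_compact isCompact_Icc)
  simp only [hv, hv', proj_leafPoint_right, proj_leafPoint_top, sub_self, zero_add] at h
  exact h

/-- The `θ₃`-derivative of the leaf integral would be the integral of `∂₃r = -(∂₁p + ∂₂q)`, which is
zero. Integrating `∂₃r` in `θ₃` first and applying Fubini avoids differentiation under the integral
sign. -/
lemma leafIntegral_eq_of_divergence_eq_zero {p q r : smoothFun}
    (h : pder 0 p + pder 1 q + pder 2 r = 0) (s s' u : ℝ) :
    leafIntegral r s u = leafIntegral r s' u := by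
  have hd : ∀ (z : ℝ × ℝ) (σ : ℝ), HasDerivAt (fun σ => r.1 (proj (leafPoint σ u z)))
      ((pder 2 r).1 (proj (leafPoint σ u z))) σ := by
    intro z σ
    rw [pder_apply_proj]
    refine (smoothFun_differentiableAt r _).hasFDerivAt.comp_hasDerivAt σ ?_
    have h1 : HasDerivAt (fun σ : ℝ => σ • e 2 + u • e 3) (e 2) σ := by
      simpa using ((hasDerivAt_id σ).smul_const (e 2)).add_const (u • e 3)
    exact h1.const_add _
  have hc : ∀ z : ℝ × ℝ, Continuous fun σ => (pder 2 r).1 (proj (leafPoint σ u z)) := fun z =>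
    (continuous_leaf (pder 2 r) u).comp (by fun_prop : Continuous fun σ : ℝ => (z, σ))
  have hint : ∀ z : ℝ × ℝ, r.1 (proj (leafPoint s u z)) - r.1 (proj (leafPoint s' u z))
      = ∫ σ in s'..s, (pder 2 r).1 (proj (leafPoint σ u z)) := fun z =>
    (intervalIntegral.integral_eq_sub_of_hasDerivAt (fun σ _ => hd z σ)
      ((hc z).intervalIntegrable _ _)).symm
  have hzero : ∀ σ, leafIntegral (pder 2 r) σ u = 0 := fun σ => by
    have : pder 2 r = pder 0 (-p) + pder 1 (-q) := by
      rw [map_neg, map_neg]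
      linear_combination h
    rw [this, leafIntegral_divergence]
  rw [← sub_eq_zero, leafIntegral, leafIntegral, ← MeasureTheory.integral_sub
    ((continuous_leaf_fixed r s u).continuousOn.integrableOn_compact isCompact_leafBox)
    ((continuous_leaf_fixed r s' u).continuousOn.integrableOn_compact isCompact_leafBox)]
  simp only [hint]
  have hswap := MeasureTheory.intervalIntegral_integral_swap
    (μ := MeasureTheory.volume.restrict leafBox) (a := s') (b := s)
    (f := fun σ z => (pder 2 r).1 (proj (leafPoint σ u z))) (by
      rw [Set.uIoc, MeasureTheory.Measure.prod_restrict]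
      refine MeasureTheory.IntegrableOn.mono_set (t := Set.Icc (min s' s) (max s' s) ×ˢ leafBox)
        ?_ (Set.prod_mono Set.Ioc_subset_Icc_self subset_rfl)
      exact ((continuous_leaf (pder 2 r) u).comp continuous_swap).continuousOn.integrableOn_compact
        (isCompact_Icc.prod isCompact_leafBox))
  rw [← hswap]
  change ∫ σ in s'..s, leafIntegral (pder 2 r) σ u = 0
  simp only [hzero, intervalIntegral.integral_zero]

lemma leafIntegral_add (f g : smoothFun) (s u : ℝ) :
    leafIntegral (f + g) s u = leafIntegral f s u + leafIntegral g s u :=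
  MeasureTheory.integral_add
    ((continuous_leaf_fixed f s u).continuousOn.integrableOn_compact isCompact_leafBox)
    ((continuous_leaf_fixed g s u).continuousOn.integrableOn_compact isCompact_leafBox)

/-- The integral of a closed 2-form over the leaf `θ₃ = s`, `θ₄ = u` does not depend on `s`. -/
lemma leafIntegral_closed {om : Form 2} (h : d om = 0) (s s' u : ℝ) :
    leafIntegral (coeff2 om 0 1) s u = leafIntegral (coeff2 om 0 1) s' u := by
  refine leafIntegral_eq_of_divergence_eq_zero (p := coeff2 om 1 2) (q := -coeff2 om 0 2) ?_ s s' u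
  rw [map_neg, ← sub_eq_add_neg]
  exact closed_coeff h 0 1 2

lemma leafIntegral_d (γ : Form 1) (s u : ℝ) : leafIntegral (coeff2 (d γ) 0 1) s u = 0 := by
  have h : coeff2 (d γ) 0 1 = pder 0 (coeff1 γ 1) + pder 1 (-coeff1 γ 0) := by
    rw [coeff2_d, map_neg, sub_eq_add_neg]
  rw [h, leafIntegral_divergence]

lemma leafIntegral_of_eq_const {f : smoothFun} {s u c : ℝ}
    (h : ∀ p, f.1 (proj (leafPoint s u p)) = c) :
    leafIntegral f s u = (2 * Real.pi) ^ 2 * c := by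
  have hπ : (0 : ℝ) ≤ 2 * Real.pi := by positivity
  have hvol : MeasureTheory.volume.real leafBox = (2 * Real.pi) ^ 2 := by
    rw [leafBox, Set.Icc_prod_eq, MeasureTheory.measureReal_def, MeasureTheory.Measure.volume_eq_prod,
      MeasureTheory.Measure.prod_prod, ENNReal.toReal_mul]
    simp only [Real.volume_Icc, sub_zero, ENNReal.toReal_ofReal hπ]
    ring
  simp only [leafIntegral, h, MeasureTheory.integral_const, MeasureTheory.measureReal_restrict_apply_univ,
    hvol, smul_eq_mul]

/-! ### The forms `f(θ₃) dθ₁ ∧ dθ₃ + g(θ₄) dθ₂ ∧ dθ₄` -/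

/-- A smooth function of the angle `θᵢ`. -/
def angleFun (i : Fin 4) {f : S1 → ℝ} (hf : IsSmoothS1 f) : smoothFun :=
  ⟨fun q => f (q i), comp_coord_smooth hf i⟩

lemma pder_angleFun (l i : Fin 4) {f : S1 → ℝ} (hf : IsSmoothS1 f) (x : V) :
    (pder l (angleFun i hf)).1 (proj x) = deriv (fun t : ℝ => f t) (x i) * e l i := by
  rw [pder_apply_proj]
  have hd : HasDerivAt (fun t : ℝ => f t) (deriv (fun t : ℝ => f t) (x i)) (x i) :=
    ((ContDiff.differentiable (n := ∞) hf (by simp)).differentiableAt).hasDerivAt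
  have h := hd.comp_hasFDerivAt x (ContinuousLinearMap.proj (R := ℝ) (φ := fun _ : Fin 4 => ℝ) i).hasFDerivAt
  have h' : HasFDerivAt (fun z => (angleFun i hf).1 (proj z)) _ x := h
  rw [h'.fderiv]
  rfl

section

variable {f g : S1 → ℝ} (hf : IsSmoothS1 f) (hg : IsSmoothS1 g)

lemma coeff2_formB (i j : Fin 4) :
    coeff2 (formB f g hf hg) i j = dθ2 0 2 ![e i, e j] • angleFun 2 hf
      + dθ2 1 3 ![e i, e j] • angleFun 3 hg := by
  refine smoothFun_ext fun x => ?_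
  change f _ * dθ2 0 2 ![e i, e j] + g _ * dθ2 1 3 ![e i, e j] = _ * f _ + _ * g _
  ring

/-- Each coefficient depends only on an angle whose differential already occurs in its term, and no
term contains `dθ₁ ∧ dθ₂`. -/
lemma formB_mem_closedHor : formB f g hf hg ∈ closedHor eta 2 := by
  constructor
  · rw [SetLike.mem_coe, mem_horForm_two, coeff2_formB]
    simp [dθ2_apply, e_apply]
  · change d (formB f g hf hg) = 0
    refine Form.ext_coeff3 fun i j k => ?_
    rw [coeff3_d]
    simp only [coeff2_formB, map_add, Derivation.map_smul]
    refine smoothFun_ext fun x => ?_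
    change (_ * (pder i (angleFun 2 hf)).1 (proj x) + _ * (pder i (angleFun 3 hg)).1 (proj x))
      - (_ * (pder j (angleFun 2 hf)).1 (proj x) + _ * (pder j (angleFun 3 hg)).1 (proj x))
      + (_ * (pder k (angleFun 2 hf)).1 (proj x) + _ * (pder k (angleFun 3 hg)).1 (proj x)) = 0
    simp only [pder_angleFun, dθ2_apply]
    ring

/-- Here `ι_{∂₃}B = -f dθ₁` and `ι_{∂₄}B = -g dθ₂`, so the primitive is `2fg dθ₁ ∧ dθ₂`. -/
lemma coeff2_primitive_formB (i j : Fin 4) :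
    coeff2 (primitive (formB f g hf hg)) i j
      = (2 * dθ2 0 1 ![e i, e j]) • (angleFun 2 hf * angleFun 3 hg) := by
  have h2 : ∀ i, coeff2 (formB f g hf hg) 2 i = (-e i 0) • angleFun 2 hf := fun i => by
    rw [coeff2_formB]
    simp [dθ2_apply, e_apply]
  have h3 : ∀ i, coeff2 (formB f g hf hg) 3 i = (-e i 1) • angleFun 3 hg := fun i => by
    rw [coeff2_formB]
    simp [dθ2_apply, e_apply]
  rw [coeff2_primitive, h2, h3, h2, h3, dθ2_apply]
  refine smoothFun_ext fun x => ?_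
  change 2 * ((-e i 0 * f _) * (-e j 1 * g _) - (-e j 0 * f _) * (-e i 1 * g _))
    = (2 * (e i 0 * e j 1 - e j 0 * e i 1)) * (f _ * g _)
  ring

lemma koszul_formB (x : V) :
    (koszul biv (formB f g hf hg) (formB f g hf hg)).1 (proj x)
      = (2 : ℝ) • ((f (x 2) * deriv (fun t : ℝ => g t) (x 3)) • dθ3 0 1 3
        + (g (x 3) * deriv (fun t : ℝ => f t) (x 2)) • dθ3 0 1 2) := by
  rw [← lam2_eq_koszul, ← d_primitive (formB_mem_closedHor hf hg).2]
  refine alt_three_ext fun i j k => ?_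
  have h := congrFun (congrArg Subtype.val (coeff3_d (primitive (formB f g hf hg)) i j k)) (proj x)
  simp only [coeff2_primitive_formB, Derivation.map_smul, Derivation.leibniz, smul_eq_mul] at h
  refine h.trans ?_
  have hp : ∀ l, (pder l (angleFun 2 hf)).1 (proj x) = deriv (fun t : ℝ => f t) (x 2) * e l 2 :=
    fun l => pder_angleFun l 2 hf x
  have hq : ∀ l, (pder l (angleFun 3 hg)).1 (proj x) = deriv (fun t : ℝ => g t) (x 3) * e l 3 :=
    fun l => pder_angleFun l 3 hg x
  change (_ * (f (x 2) * (pder i (angleFun 3 hg)).1 (proj x)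
      + g (x 3) * (pder i (angleFun 2 hf)).1 (proj x)))
    - (_ * (f (x 2) * (pder j (angleFun 3 hg)).1 (proj x)
      + g (x 3) * (pder j (angleFun 2 hf)).1 (proj x)))
    + (_ * (f (x 2) * (pder k (angleFun 3 hg)).1 (proj x)
      + g (x 3) * (pder k (angleFun 2 hf)).1 (proj x)))
    = 2 * (_ * dθ3 0 1 3 ![e i, e j, e k] + _ * dθ3 0 1 2 ![e i, e j, e k])
  simp only [hp, hq, dθ2_apply, dθ3_apply]
  ring

lemma leafIntegral_primitive_formB (s u : ℝ) :
    leafIntegral (coeff2 (primitive (formB f g hf hg)) 0 1) s u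
      = (2 * Real.pi) ^ 2 * (2 * (f s * g u)) := by
  refine leafIntegral_of_eq_const fun p => ?_
  rw [coeff2_primitive_formB]
  have h : proj (leafPoint s u p) 2 = s ∧ proj (leafPoint s u p) 3 = u := by
    rw [leafPoint_apply]
    exact ⟨rfl, rfl⟩
  change 2 * dθ2 0 1 ![e 0, e 1] * (f (proj (leafPoint s u p) 2) * g (proj (leafPoint s u p) 3)) = _
  rw [h.1, h.2, dθ2_apply]
  simp [e_apply]

lemma leafIntegral_of_hor {om : Form 2} (h : om ∈ horForm eta 2) (s u : ℝ) :
    leafIntegral (coeff2 om 0 1) s u = 0 := by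
  rw [mem_horForm_two.1 h, leafIntegral_of_eq_const (c := 0) fun _ => rfl, mul_zero]

/-- If `[λ₂(w, w)] = 0`, then the leaf integrals of the primitive do not depend on `θ₃`. -/
lemma leafIntegral_primitive_of_exact {w : closedHor eta 2} (h : kuranishi (cls w) = 0)
    (s s' u : ℝ) :
    leafIntegral (coeff2 (primitive w.1) 0 1) s u
      = leafIntegral (coeff2 (primitive w.1) 0 1) s' u := by
  have h0 : (0 : HHor eta 2) = cls 0 := rfl
  rw [kuranishi_cls, h0] at h
  obtain ⟨β, hβ, h⟩ := cls_eq_iff.1 h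
  have hcl : d (primitive w.1 - β) = 0 := by
    rw [map_sub, h, d_primitive w.2.2]
    exact sub_eq_zero.2 (sub_zero _).symm
  have hsum : coeff2 (primitive w.1) 0 1
      = coeff2 (primitive w.1 - β) 0 1 + coeff2 β 0 1 :=
    (sub_add_cancel (coeff2 (primitive w.1) 0 1) (coeff2 β 0 1)).symm
  rw [hsum, leafIntegral_add, leafIntegral_add, leafIntegral_of_hor hβ, leafIntegral_of_hor hβ,
    leafIntegral_closed hcl s s' u]

lemma kuranishi_formB_ne_zero (h : ∃ a b : S1, g 0 * (f b - f a) ≠ 0) :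
    kuranishi (cls ⟨formB f g hf hg, formB_mem_closedHor hf hg⟩) ≠ 0 := by
  intro h0
  obtain ⟨a, b, hab⟩ := h
  obtain ⟨s, rfl⟩ := QuotientAddGroup.mk_surjective a
  obtain ⟨s', rfl⟩ := QuotientAddGroup.mk_surjective b
  -- On the slice `θ₄ = 0` the integrals are `2(2π)² f(a)g(0)` and `2(2π)² f(b)g(0)`.
  have h := leafIntegral_primitive_of_exact h0 s s' 0
  rw [leafIntegral_primitive_formB, leafIntegral_primitive_formB] at h
  have hg0 : g ((0 : ℝ) : S1) = g 0 := rfl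
  rw [hg0] at h
  have h' := mul_left_cancel₀ (by positivity) h
  apply hab
  linarith

end

/-- The two primitives differ by a horizontal and an exact form, both with zero leaf integral. The
value computed for `B` thus applies to every representative of its class. -/
lemma leafIntegral_primitive_congr {w w' : closedHor eta 2} (h : cls w = cls w') (s u : ℝ) :
    leafIntegral (coeff2 (primitive w.1) 0 1) s u
      = leafIntegral (coeff2 (primitive w'.1) 0 1) s u := by
  obtain ⟨α, hα, h⟩ := cls_eq_iff.1 h
  obtain ⟨γ, hγ⟩ := primitive_sub_primitive_sub_d_mem hα h
  have hsum : coeff2 (primitive w.1) 0 1 = coeff2 (primitive w.1 - primitive w'.1 - d γ) 0 1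
      + coeff2 (d γ) 0 1 + coeff2 (primitive w'.1) 0 1 := by
    change _ = coeff2 (primitive w.1) 0 1 - coeff2 (primitive w'.1) 0 1 - coeff2 (d γ) 0 1
      + coeff2 (d γ) 0 1 + coeff2 (primitive w'.1) 0 1
    ring
  rw [hsum, leafIntegral_add, leafIntegral_add, leafIntegral_of_hor hγ, leafIntegral_d]
  ring

/-! ### Formal obstruction -/

lemma kuranishi_eq_zero_of_extendsFormally {w : closedHor eta 2}
    (h : ExtendsFormally eta biv w.1) : kuranishi (cls w) = 0 := by
  obtain ⟨v, ⟨hv0, hvhor, hv⟩, hv1⟩ := h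
  -- At order `t²` only the pair `(1, 1)` survives, since `v 0 = 0`: `d(v 2) + ½λ₂(w,w) = 0`. This
  -- yields the horizontal primitive `-2 v 2`.
  have h2 := hv 2
  simp only [lam3_biv, Finset.sum_const_zero, smul_zero, add_zero,
    Finset.Nat.antidiagonal_succ, Finset.Nat.antidiagonal_zero] at h2
  simp [hv0, hv1] at h2
  rw [lam2_zero_left, lam2_zero_right, smul_zero, zero_add, add_zero] at h2
  have h0 : (0 : HHor eta 2) = cls 0 := rfl
  rw [kuranishi_cls, h0]
  refine cls_eq_iff.2 ⟨(-2 : ℝ) • v 2, (horForm eta 2).smul_mem _ (hvhor 2), ?_⟩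
  change d ((-2 : ℝ) • v 2) = lam2 biv w.1 w.1 - (0 : Form 3)
  rw [map_smul, eq_neg_of_add_eq_zero_left h2]
  module

/-! ### Conservation laws for Maurer–Cartan elements and pre-symplectic forms -/

/-- The function `w₁₃ w₂₄ - w₁₄ w₂₃` (in the angles `θ₁, …, θ₄`). -/
def mixedPfaffian (w : Form 2) : smoothFun :=
  coeff2 w 0 2 * coeff2 w 1 3 - coeff2 w 0 3 * coeff2 w 1 2

lemma coeff2_primitive_zero_one (w : Form 2) :
    coeff2 (primitive w) 0 1 = mixedPfaffian w + mixedPfaffian w := by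
  rw [coeff2_primitive, coeff2_swap w 2 0, coeff2_swap w 3 1, coeff2_swap w 2 1,
    coeff2_swap w 3 0, mixedPfaffian]
  ring

lemma smoothFun_eq_zero_of_two_mul {f : smoothFun} (h : 2 * f = 0) : f = 0 := by
  refine smoothFun_ext fun x => ?_
  have h' : 2 * f.1 (proj x) = 0 := congrFun (congrArg Subtype.val h) (proj x)
  change f.1 (proj x) = 0
  linarith

/-- Doubling clears the scalar `½`, so that the equation can be used over the ring of functions. -/
lemma IsMC.coeff {β : Form 2} (h : IsMC eta biv β) (i j k : Fin 4) :
    2 * coeff3 (d β) i j k + coeff3 (koszul biv β β) i j k = 0 := by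
  have h1 := h.2
  rw [lam3_biv, smul_zero, add_zero, lam2_eq_koszul] at h1
  refine smoothFun_ext fun x => ?_
  have h2 := congrArg (fun om : Form 3 => (coeff3 om i j k).1 (proj x)) h1
  change (coeff3 (d β) i j k).1 (proj x) + 2⁻¹ * (coeff3 (koszul biv β β) i j k).1 (proj x) = 0
    at h2
  change 2 * (coeff3 (d β) i j k).1 (proj x) + (coeff3 (koszul biv β β) i j k).1 (proj x) = 0
  linarith

/-- The divergence below is the `(∂₁,∂₂,∂₃)`-coefficient of the differential of a 2-form with
coefficients `ω₁₂ = (β₁₃β₂₄ - β₁₄β₂₃)I`, `ω₁₃ = β₁₃I`, `ω₂₃ = β₂₃I`, where `I = 1/(1 - β₃₄)`. With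
`ω₃₄ = I`, `ω₁₄ = β₁₄I` and `ω₂₄ = β₂₄I` this is a form of zero Pfaffian, the counterpart of `β`
among deformations of `η`. -/
lemma IsMC.leafIntegral_eq {β : Form 2} (h : IsMC eta biv β) {I : smoothFun}
    (hI : (1 - coeff2 β 2 3) * I = 1) (s s' u : ℝ) :
    leafIntegral (mixedPfaffian β * I) s u = leafIntegral (mixedPfaffian β * I) s' u := by
  have h012 := h.coeff 0 1 2
  have h023 := h.coeff 0 2 3
  have h123 := h.coeff 1 2 3
  simp only [coeff3_koszul, coeff3_d, contrWedge, coeff2_self,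
    coeff2_swap β 2 0, coeff2_swap β 3 0, coeff2_swap β 2 1, coeff2_swap β 3 1, coeff2_swap β 3 2,
    mem_horForm_two.1 h.1] at h012 h023 h123
  have hI' : ∀ l, pder l I = I ^ 2 * pder l (coeff2 β 2 3) := fun l => by
    have h := congrArg (pder l) hI
    simp only [Derivation.leibniz, smul_eq_mul, map_sub, Derivation.map_one_eq_zero] at h
    linear_combination I * h - (pder l I) * hI
  refine leafIntegral_eq_of_divergence_eq_zero (p := coeff2 β 1 2 * I) (q := -(coeff2 β 0 2 * I))
    ?_ s s' u
  refine smoothFun_eq_zero_of_two_mul ?_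
  rw [mixedPfaffian]
  simp only [map_add, map_sub, map_neg, map_zero, Derivation.leibniz, smul_eq_mul, hI']
    at h012 h023 h123 ⊢
  set a := coeff2 β 0 2
  set b := coeff2 β 0 3
  set c := coeff2 β 1 2
  set e' := coeff2 β 1 3
  set h' := coeff2 β 2 3
  have e012 : 2 * (pder 0 c - pder 1 a + e' * pder 2 a - b * pder 2 c + a * pder 3 c - c * pder 3 a)
      = 0 := by linear_combination h012
  have e023 : 2 * (pder 0 h' - (1 - h') * (pder 2 b - pder 3 a) - b * pder 2 h' + a * pder 3 h')
      = 0 := by linear_combination h023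
  have e123 : 2 * (pder 1 h' - (1 - h') * (pder 2 e' - pder 3 c) - e' * pder 2 h' + c * pder 3 h')
      = 0 := by linear_combination h123
  -- Differentiating `I` brings in `∂₁β₃₄` and `∂₂β₃₄`, which `e023` and `e123` eliminate; `hI`
  -- reduces `I²(1 - β₃₄)` to `I`.
  linear_combination I ^ 2 * (1 - h') * e012 + I ^ 2 * c * e023 - I ^ 2 * a * e123
    - 2 * I * (pder 0 c - pder 1 a + (pder 2 a * e' + a * pder 2 e' - b * pder 2 c - c * pder 2 b)) * hI

/-- A skew `4 × 4` matrix with nonzero Pfaffian is invertible, whereas the rank is 2. -/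
lemma IsPreSymplectic.pfaffian_eq_zero {ζ : Form 2} (h : IsPreSymplectic 2 ζ) :
    coeff2 ζ 0 1 * coeff2 ζ 2 3 - mixedPfaffian ζ = 0 := by
  refine smoothFun_ext fun x => ?_
  by_contra hne
  have hrank := h.2 (proj x)
  set q := proj x
  set A : Fin 4 → Fin 4 → ℝ := fun i j => flat ζ q (e i) (e j) with hA
  have hswap : ∀ i j, A i j = -A j i := fun i j => by
    rw [hA]
    simp only [flat_apply]
    exact alt_two_swap _ _ _
  have hc : ∀ i j, (coeff2 ζ i j).1 q = A i j := fun i j => (flat_apply ζ q (e i) (e j)).symm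
  have hne' : A 0 1 * A 2 3 - (A 0 2 * A 1 3 - A 0 3 * A 1 2) ≠ 0 := by
    simp only [← hc]
    exact hne
  have hker : LinearMap.ker (flat ζ q) = ⊥ := by
    refine LinearMap.ker_eq_bot'.2 fun v hv => ?_
    have hexp : v = v 0 • e 0 + v 1 • e 1 + v 2 • e 2 + v 3 • e 3 := by
      ext i
      fin_cases i <;> simp [e_apply]
    have hj : ∀ j, v 0 * A 0 j + v 1 * A 1 j + v 2 * A 2 j + v 3 * A 3 j = 0 := fun j => by
      have h1 : flat ζ q v (e j) = 0 := by rw [hv]; rfl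
      rw [hexp] at h1
      simpa using h1
    have h00 : ∀ i, A i i = 0 := fun i => by have := hswap i i; linarith
    have j0 := hj 0
    have j1 := hj 1
    have j2 := hj 2
    have j3 := hj 3
    rw [h00, hswap 1 0, hswap 2 0, hswap 3 0] at j0
    rw [h00, hswap 2 1, hswap 3 1] at j1
    rw [h00, hswap 3 2] at j2
    rw [h00] at j3
    ext i
    -- The Pfaffian adjugate of `A` combines the four equations `j0`, …, `j3` into `Pf(A) · v i =
    -- 0`.
    refine (mul_eq_zero.1 ?_).resolve_left hne'
    fin_cases i
    · change _ * v 0 = 0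
      linear_combination A 2 3 * j1 - A 1 3 * j2 + A 1 2 * j3
    · change _ * v 1 = 0
      linear_combination -A 2 3 * j0 + A 0 3 * j2 - A 0 2 * j3
    · change _ * v 2 = 0
      linear_combination A 1 3 * j0 - A 0 3 * j1 + A 0 1 * j3
    · change _ * v 3 = 0
      linear_combination -A 1 2 * j0 + A 0 2 * j1 - A 0 1 * j2
  have := LinearMap.finrank_range_add_finrank_ker (flat ζ q)
  rw [hker, hrank] at this
  simp at this

/-- The vanishing Pfaffian identifies the integrand with `ζ₁₂`, to which Stokes applies. -/
lemma IsPreSymplectic.leafIntegral_eq {ζ : Form 2} (h : IsPreSymplectic 2 ζ) {I : smoothFun}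
    (hI : coeff2 ζ 2 3 * I = 1) (s s' u : ℝ) :
    leafIntegral (mixedPfaffian ζ * I) s u = leafIntegral (mixedPfaffian ζ * I) s' u := by
  have h1 : mixedPfaffian ζ * I = coeff2 ζ 0 1 := by
    linear_combination -I * h.pfaffian_eq_zero + coeff2 ζ 0 1 * hI
  rw [h1, leafIntegral_closed h.1 s s' u]

/-! ### Smooth families -/

lemma exists_proj_eq_mem_box (q : T4) :
    ∃ x ∈ Set.Icc (0 : V) (fun _ => 2 * Real.pi), proj x = q := by
  have : Fact (0 < 2 * Real.pi) := ⟨Real.two_pi_pos⟩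
  have h : ∀ i, ∃ t ∈ Set.Icc (0 : ℝ) (0 + 2 * Real.pi), (t : S1) = q i := fun i => by
    have : q i ∈ (QuotientAddGroup.mk '' Set.Icc (0 : ℝ) (0 + 2 * Real.pi) : Set S1) := by
      rw [AddCircle.coe_image_Icc_eq]
      trivial
    exact this
  choose x hx hq using h
  refine ⟨x, ⟨fun i => (hx i).1, fun i => ?_⟩, funext hq⟩
  have := (hx i).2
  simpa using this

lemma abs_alt_two_le (a : Alt 2) (i j : Fin 4) : |a ![e i, e j]| ≤ ‖a‖ := by
  have h := a.le_opNorm ![e i, e j]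
  have he : ∀ i, ‖e i‖ = 1 := fun i => by rw [e, Pi.norm_single, norm_one]
  simpa [Fin.prod_univ_two, he] using h

/-! ### Uniform bounds and one-sided limits of a family at time zero -/

section

variable {ε : ℝ} {F : ℝ → Form 2} {w : Form 2}

/-- A smooth map is Lipschitz on a compact convex set. The box covers `T⁴`, which makes the constant
uniform in `q`; halving `ε` keeps the closed time interval inside `[0, ε)`. -/
lemma IsSmoothFamily.exists_lipschitz (hF : IsSmoothFamily ε F w) (hε : 0 < ε) :
    ∃ K : ℝ, 0 ≤ K ∧ ∀ t ∈ Set.Icc 0 (ε / 2), ∀ (q : T4) (i j : Fin 4),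
      |(coeff2 (F t) i j).1 q - (coeff2 (F 0) i j).1 q| ≤ K * t := by
  set S : Set (ℝ × V) := Set.Icc 0 (ε / 2) ×ˢ Set.Icc (0 : V) (fun _ => 2 * Real.pi)
  have hS : S ⊆ Set.Ico 0 ε ×ˢ Set.univ :=
    Set.prod_mono (fun t ht => ⟨ht.1, by linarith [ht.2]⟩) (Set.subset_univ _)
  obtain ⟨K, hK⟩ := (hF.1.mono hS).exists_lipschitzOnWith (by simp)
    ((convex_Icc _ _).prod (convex_Icc _ _)) (isCompact_Icc.prod isCompact_Icc)
  refine ⟨K, K.2, fun t ht q i j => ?_⟩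
  obtain ⟨x, hx, rfl⟩ := exists_proj_eq_mem_box q
  have h := hK.norm_sub_le (x := (t, x)) (y := (0, x)) ⟨ht, hx⟩ ⟨⟨le_rfl, by linarith⟩, hx⟩
  have hn : ‖((t, x) : ℝ × V) - (0, x)‖ = t := by
    simp [Prod.norm_def, abs_of_nonneg ht.1, ht.1]
  rw [hn] at h
  exact (abs_alt_two_le _ i j).trans h

lemma IsSmoothFamily.hasDerivWithinAt_coeff (hF : IsSmoothFamily ε F w) (q : T4) (i j : Fin 4) :
    HasDerivWithinAt (fun t => (coeff2 (F t) i j).1 q) ((coeff2 w i j).1 q) (Set.Ici 0) 0 :=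
  (ContinuousAlternatingMap.apply ℝ V ℝ ![e i, e j]).hasFDerivAt.comp_hasDerivWithinAt 0 (hF.2 q)

lemma IsSmoothFamily.tendsto_coeff_div (hF : IsSmoothFamily ε F w) {i j : Fin 4}
    (h0 : coeff2 (F 0) i j = 0) (q : T4) :
    Filter.Tendsto (fun t => (coeff2 (F t) i j).1 q / t) (nhdsWithin 0 (Set.Ioi 0))
      (nhds ((coeff2 w i j).1 q)) := by
  have h := hF.hasDerivWithinAt_coeff q i j
  rw [hasDerivWithinAt_iff_tendsto_slope, Set.Ici_sdiff_left] at h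
  refine h.congr fun t => ?_
  rw [slope_def_field, h0]
  change (_ - 0) / (t - 0) = _
  rw [sub_zero, sub_zero]

lemma IsSmoothFamily.tendsto_coeff (hF : IsSmoothFamily ε F w) (i j : Fin 4) (q : T4) :
    Filter.Tendsto (fun t => (coeff2 (F t) i j).1 q) (nhdsWithin 0 (Set.Ioi 0))
      (nhds ((coeff2 (F 0) i j).1 q)) :=
  ((hF.hasDerivWithinAt_coeff q i j).continuousWithinAt.mono Set.Ioi_subset_Ici_self).tendsto

end

lemma exists_mul_eq_one {f : smoothFun} (h : ∀ q, f.1 q ≠ 0) : ∃ g : smoothFun, f * g = 1 := by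
  refine ⟨⟨fun q => (f.1 q)⁻¹, ContDiff.inv (n := ∞) f.2 fun x => h (proj x)⟩, ?_⟩
  exact smoothFun_ext fun x => mul_inv_cancel₀ (h (proj x))

/-- Let `Fₜ` be a smooth family of 2-forms with velocity `w` whose mixed coefficients vanish at
`t = 0`, and let `Dₜ = 1 + σ (Fₜ - F₀)(∂₃, ∂₄)`. If for small `t` the leaf integrals of
`(Fₜ(∂₁, ∂₃) Fₜ(∂₂, ∂₄) - Fₜ(∂₁, ∂₄) Fₜ(∂₂, ∂₃)) / Dₜ` do not depend on `θ₃`, then the same holds for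
`w(∂₁, ∂₃) w(∂₂, ∂₄) - w(∂₁, ∂₄) w(∂₂, ∂₃)`. -/
lemma leafIntegral_mixedPfaffian_eq {ε σ : ℝ} (hε : 0 < ε) {F : ℝ → Form 2} {w : Form 2}
    (hF : IsSmoothFamily ε F w) (hσ : |σ| ≤ 1)
    (h02 : coeff2 (F 0) 0 2 = 0) (h03 : coeff2 (F 0) 0 3 = 0) (h12 : coeff2 (F 0) 1 2 = 0)
    (h13 : coeff2 (F 0) 1 3 = 0) {s s' u : ℝ}
    (h : ∀ t ∈ Set.Ico 0 ε, ∀ I : smoothFun,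
      (1 + σ • (coeff2 (F t) 2 3 - coeff2 (F 0) 2 3)) * I = 1 →
      leafIntegral (mixedPfaffian (F t) * I) s u = leafIntegral (mixedPfaffian (F t) * I) s' u) :
    leafIntegral (mixedPfaffian w) s u = leafIntegral (mixedPfaffian w) s' u := by
  obtain ⟨K, hK0, hK⟩ := hF.exists_lipschitz hε
  set D : ℝ → smoothFun := fun t => 1 + σ • (coeff2 (F t) 2 3 - coeff2 (F 0) 2 3) with hD
  have hDq : ∀ t q, (D t).1 q = 1 + σ * ((coeff2 (F t) 2 3).1 q - (coeff2 (F 0) 2 3).1 q) :=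
    fun t q => rfl
  have hex : ∀ t, ∃ I : smoothFun, (∀ q, (D t).1 q ≠ 0) → D t * I = 1 := fun t => by
    by_cases hne : ∀ q, (D t).1 q ≠ 0
    · obtain ⟨g, hg⟩ := exists_mul_eq_one hne
      exact ⟨g, fun _ => hg⟩
    · exact ⟨0, fun h => absurd h hne⟩
  choose I hI using hex
  -- `K * δ ≤ 1/2` keeps `D t` above `1/2`; `K + 1` guards against `K = 0`.
  obtain ⟨δ, hδ, hδε, hKδ⟩ : ∃ δ > 0, δ ≤ ε / 2 ∧ K * δ ≤ 1 / 2 := by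
    refine ⟨min (ε / 2) (1 / (2 * (K + 1))), by positivity, min_le_left _ _, ?_⟩
    calc K * min (ε / 2) (1 / (2 * (K + 1))) ≤ (K + 1) * (1 / (2 * (K + 1))) :=
          mul_le_mul (by linarith) (min_le_right _ _) (by positivity) (by positivity)
      _ = 1 / 2 := by field_simp
  have hev : ∀ᶠ t in nhdsWithin (0 : ℝ) (Set.Ioi 0), 0 < t ∧ t ≤ δ := by
    filter_upwards [Ioc_mem_nhdsGT hδ] with t ht using ht
  have hDge : ∀ t, 0 < t ∧ t ≤ δ → ∀ q, 1 / 2 ≤ (D t).1 q := by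
    intro t ht q
    have h1 := hK t ⟨ht.1.le, ht.2.trans hδε⟩ q 2 3
    have h2 : K * t ≤ 1 / 2 := (mul_le_mul_of_nonneg_left ht.2 hK0).trans hKδ
    have h3 : |σ * ((coeff2 (F t) 2 3).1 q - (coeff2 (F 0) 2 3).1 q)| ≤ 1 * (1 / 2) := by
      rw [abs_mul]
      exact mul_le_mul hσ (h1.trans h2) (abs_nonneg _) zero_le_one
    rw [hDq]
    linarith [(abs_le.1 h3).1]
  have hIq : ∀ t, 0 < t ∧ t ≤ δ → D t * I t = 1 := fun t ht =>
    hI t fun q => (lt_of_lt_of_le (by norm_num) (hDge t ht q)).ne'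
  have hIinv : ∀ t, 0 < t ∧ t ≤ δ → ∀ q, (I t).1 q = ((D t).1 q)⁻¹ := fun t ht q =>
    eq_inv_of_mul_eq_one_right (congrFun (congrArg Subtype.val (hIq t ht)) q)
  have hNq : ∀ (v : Form 2) q, (mixedPfaffian v).1 q = (coeff2 v 0 2).1 q * (coeff2 v 1 3).1 q
    - (coeff2 v 0 3).1 q * (coeff2 v 1 2).1 q := fun v q => rfl
  -- The mixed coefficients vanish at `t = 0`, so each one divided by `t` tends to its velocity,
  -- while `D t` tends to `1`.
  have hpt : ∀ q, Filter.Tendsto (fun t => (mixedPfaffian (F t) * I t).1 q / t ^ 2)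
      (nhdsWithin 0 (Set.Ioi 0)) (nhds ((mixedPfaffian w).1 q)) := by
    intro q
    have hDt : Filter.Tendsto (fun t => (D t).1 q) (nhdsWithin 0 (Set.Ioi 0)) (nhds 1) := by
      have := (((hF.tendsto_coeff 2 3 q).sub_const ((coeff2 (F 0) 2 3).1 q)).const_mul σ).const_add 1
      simpa [hDq] using this
    have hlim := (((hF.tendsto_coeff_div h02 q).mul (hF.tendsto_coeff_div h13 q)).sub
      ((hF.tendsto_coeff_div h03 q).mul (hF.tendsto_coeff_div h12 q))).mul (hDt.inv₀ one_ne_zero)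
    rw [inv_one, mul_one] at hlim
    refine hlim.congr' ?_
    filter_upwards [hev] with t ht
    have hmul : (mixedPfaffian (F t) * I t).1 q = (mixedPfaffian (F t)).1 q * (I t).1 q := rfl
    rw [hmul, hNq, hIinv t ht q]
    have := ht.1.ne'
    field_simp
  -- Two products of size at most `(Kt)²` and the bound `|I t| ≤ 2` give the dominating constant
  -- `4K²`.
  have hbound : ∀ t, 0 < t ∧ t ≤ δ → ∀ q,
      ‖(mixedPfaffian (F t) * I t).1 q / t ^ 2‖ ≤ 4 * K ^ 2 := by
    intro t ht q
    have hc : ∀ {i j}, coeff2 (F 0) i j = 0 → |(coeff2 (F t) i j).1 q| ≤ K * t := fun {i j} h0 => by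
      have := hK t ⟨ht.1.le, ht.2.trans hδε⟩ q i j
      rw [h0] at this
      change |_ - 0| ≤ _ at this
      rwa [sub_zero] at this
    have hKt : 0 ≤ K * t := mul_nonneg hK0 ht.1.le
    have hN : |(mixedPfaffian (F t)).1 q| ≤ K * t * (K * t) + K * t * (K * t) := by
      rw [hNq]
      refine (abs_sub _ _).trans (add_le_add ?_ ?_)
      · rw [abs_mul]
        exact mul_le_mul (hc h02) (hc h13) (abs_nonneg _) hKt
      · rw [abs_mul]
        exact mul_le_mul (hc h03) (hc h12) (abs_nonneg _) hKt
    have hi : |(I t).1 q| ≤ 2 := by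
      have h2 := hDge t ht q
      rw [hIinv t ht q, abs_inv, abs_of_pos (by linarith)]
      exact (inv_anti₀ (by norm_num) h2).trans (by norm_num)
    have hmul : (mixedPfaffian (F t) * I t).1 q = (mixedPfaffian (F t)).1 q * (I t).1 q := rfl
    have ht2 : 0 < t ^ 2 := pow_pos ht.1 2
    rw [hmul, Real.norm_eq_abs, abs_div, abs_mul, abs_of_pos ht2, div_le_iff₀ ht2]
    calc |(mixedPfaffian (F t)).1 q| * |(I t).1 q|
        ≤ (K * t * (K * t) + K * t * (K * t)) * 2 :=
          mul_le_mul hN hi (abs_nonneg _) (by positivity)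
      _ = 4 * K ^ 2 * t ^ 2 := by ring
  have hmain : ∀ σ : ℝ, Filter.Tendsto (fun t => leafIntegral (mixedPfaffian (F t) * I t) σ u / t ^ 2)
      (nhdsWithin 0 (Set.Ioi 0)) (nhds (leafIntegral (mixedPfaffian w) σ u)) := by
    intro σ
    simp only [leafIntegral, ← MeasureTheory.integral_div]
    refine MeasureTheory.tendsto_integral_filter_of_dominated_convergence (fun _ => 4 * K ^ 2)
      ?_ ?_ ?_ ?_
    · exact Filter.Eventually.of_forall fun t =>
        ((continuous_leaf_fixed _ σ u).div_const _).aestronglyMeasurable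
    · filter_upwards [hev] with t ht
      exact Filter.Eventually.of_forall fun p => hbound t ht _
    · exact continuousOn_const.integrableOn_compact isCompact_leafBox
    · exact Filter.Eventually.of_forall fun p => hpt _
  refine tendsto_nhds_unique (hmain s) ((hmain s').congr' ?_)
  filter_upwards [hev] with t ht
  rw [h t ⟨ht.1.le, by linarith [ht.2]⟩ (I t) (hIq t ht)]

lemma leafIntegral_primitive_eq_of_extendsSmoothly {w : Form 2}
    (h : ExtendsSmoothly eta biv w) (s s' u : ℝ) :
    leafIntegral (coeff2 (primitive w) 0 1) s u = leafIntegral (coeff2 (primitive w) 0 1) s' u := by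
  obtain ⟨ε, hε, β, hβ, h0, hMC⟩ := h
  have hz : ∀ i j, coeff2 (β 0) i j = 0 := fun i j => by
    rw [h0]
    exact map_zero _
  -- As `β 0 = 0`, the choice `σ = -1` gives the denominator `1 - β₃₄` of the conservation law.
  have key := leafIntegral_mixedPfaffian_eq (σ := -1) (s := s) (s' := s') (u := u) hε hβ (by simp)
    (hz 0 2) (hz 0 3) (hz 1 2) (hz 1 3) fun t ht I hI => by
      refine (hMC t ht).leafIntegral_eq ?_ s s' u
      rw [hz, sub_zero, neg_one_smul, ← sub_eq_add_neg] at hI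
      exact hI
  rw [coeff2_primitive_zero_one, leafIntegral_add, leafIntegral_add, key]

lemma leafIntegral_primitive_eq_of_isPreSymplecticVelocity {w : Form 2}
    (h : IsPreSymplecticVelocity 2 eta w) (s s' u : ℝ) :
    leafIntegral (coeff2 (primitive w) 0 1) s u = leafIntegral (coeff2 (primitive w) 0 1) s' u := by
  obtain ⟨ε, hε, ζ, hζ, h0, hpre⟩ := h
  have hz : ∀ i j, coeff2 (ζ 0) i j = algebraMap ℝ smoothFun (dθ2 2 3 ![e i, e j]) := fun i j => by
    rw [h0, coeff2_eta]
  -- As `η₃₄ = 1`, the choice `σ = 1` gives the denominator `ζ₃₄`.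
  have key := leafIntegral_mixedPfaffian_eq (σ := 1) (s := s) (s' := s') (u := u) hε hζ (by simp)
    (by rw [hz]; simp [dθ2_apply, e_apply]) (by rw [hz]; simp [dθ2_apply, e_apply])
    (by rw [hz]; simp [dθ2_apply, e_apply]) (by rw [hz]; simp [dθ2_apply, e_apply])
    fun t ht I hI => by
      refine (hpre t ht).leafIntegral_eq ?_ s s' u
      have h1 : coeff2 (ζ 0) 2 3 = 1 := by rw [hz]; simp [dθ2_apply, e_apply]
      rw [h1, one_smul, add_sub_cancel] at hI
      exact hI
  rw [coeff2_primitive_zero_one, leafIntegral_add, leafIntegral_add, key]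

/-! ### The case `f = g = cos` -/

lemma cosS1_coe (t : ℝ) : cosS1 (t : S1) = Real.cos t := rfl

lemma cosS1_separates : ∃ a b : S1, cosS1 0 * (cosS1 b - cosS1 a) ≠ 0 := by
  refine ⟨((0 : ℝ) : S1), (Real.pi : S1), ?_⟩
  have h0 : cosS1 0 = Real.cos 0 := cosS1_coe 0
  rw [h0, cosS1_coe, cosS1_coe, Real.cos_zero, Real.cos_pi]
  norm_num

/-- On `θ₄ = 0` the integrals at `θ₃ = 0` and `θ₃ = π` are `2(2π)²` and `-2(2π)²`. -/
lemma leafIntegral_primitive_cos_ne {w : closedHor eta 2}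
    (hw : cls w = cls ⟨formB cosS1 cosS1 cosS1_smooth cosS1_smooth,
      formB_mem_closedHor cosS1_smooth cosS1_smooth⟩) :
    leafIntegral (coeff2 (primitive w.1) 0 1) 0 0
      ≠ leafIntegral (coeff2 (primitive w.1) 0 1) Real.pi 0 := by
  rw [leafIntegral_primitive_congr hw, leafIntegral_primitive_congr hw,
    leafIntegral_primitive_formB, leafIntegral_primitive_formB, cosS1_coe, cosS1_coe,
    Real.cos_zero, Real.cos_pi]
  intro h
  have h' := mul_left_cancel₀ (by positivity) h
  norm_num at h'

end KoszulTorus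

end

theorem mainTheorem10 :
    -- `η = dθ₃ ∧ dθ₄` is pre-symplectic of rank 2, with kernel spanned by `∂/∂θ₁`, `∂/∂θ₂`,
    -- and `π = ∂/∂θ₃ ∧ ∂/∂θ₄` is the bivector field belonging to `η` and `G`
    IsPreSymplectic 2 eta ∧
    (∀ q, kerAt eta q = Submodule.span ℝ {e 0, e 1}) ∧
    IsNegInverse eta G34 biv ∧
    -- the Kuranishi map `[w] ↦ [λ₂(w,w)]` is well defined
    (∃ Kr : HHor eta 1 → HHor eta 2,
      (∀ w : closedHor eta 2, ∃ h : lam2 biv w.1 w.1 ∈ closedHor eta 3,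
        Kr (cls w) = cls ⟨lam2 biv w.1 w.1, h⟩) ∧
      -- the forms `B = f(θ₃) dθ₁ ∧ dθ₃ + g(θ₄) dθ₂ ∧ dθ₄`
      (∀ (f g : S1 → ℝ) (hf : IsSmoothS1 f) (hg : IsSmoothS1 g),
        (∃ hB : formB f g hf hg ∈ closedHor eta 2,
          (∃ a b : S1, g 0 * (f b - f a) ≠ 0) →
            Kr (cls ⟨formB f g hf hg, hB⟩) ≠ 0) ∧
        lam2 biv (formB f g hf hg) (formB f g hf hg)
          = koszul biv (formB f g hf hg) (formB f g hf hg) ∧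
        (∀ x : V, (koszul biv (formB f g hf hg) (formB f g hf hg)).1 (proj x)
          = (2 : ℝ) • ((f (x 2) * deriv (fun t : ℝ => g t) (x 3)) • dθ3 0 1 3
            + (g (x 3) * deriv (fun t : ℝ => f t) (x 2)) • dθ3 0 1 2)) ∧
        ∃ α : Form 2, d α = koszul biv (formB f g hf hg) (formB f g hf hg)) ∧
      -- the case `f = g = cos`
      ∃ hB : formB cosS1 cosS1 cosS1_smooth cosS1_smooth ∈ closedHor eta 2,
        Kr (cls ⟨formB cosS1 cosS1 cosS1_smooth cosS1_smooth, hB⟩) ≠ 0 ∧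
        ∀ w : closedHor eta 2,
          cls w = cls ⟨formB cosS1 cosS1 cosS1_smooth cosS1_smooth, hB⟩ →
            ¬ ExtendsFormally eta biv w.1 ∧
            ¬ ExtendsSmoothly eta biv w.1 ∧
            ¬ IsPreSymplecticVelocity 2 eta w.1) := by
  refine ⟨isPreSymplectic_eta, kerAt_eta, isNegInverse_biv, kuranishi,
    fun w => ⟨lam2_mem_closedHor w, kuranishi_cls w⟩, fun f g hf hg => ⟨⟨formB_mem_closedHor hf hg,
      kuranishi_formB_ne_zero hf hg⟩, lam2_eq_koszul _ _, koszul_formB hf hg,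
      primitive (formB f g hf hg), ?_⟩,
    formB_mem_closedHor cosS1_smooth cosS1_smooth, ?_, fun w hw => ?_⟩
  · rw [d_primitive (formB_mem_closedHor hf hg).2, lam2_eq_koszul]
  · exact kuranishi_formB_ne_zero _ _ cosS1_separates
  · have hne := kuranishi_formB_ne_zero cosS1_smooth cosS1_smooth cosS1_separates
    have hvar := leafIntegral_primitive_cos_ne hw
    exact ⟨fun h => hne (hw ▸ kuranishi_eq_zero_of_extendsFormally h),
      fun h => hvar (leafIntegral_primitive_eq_of_extendsSmoothly h 0 Real.pi 0),
      fun h => hvar (leafIntegral_primitive_eq_of_isPreSymplecticVelocity h 0 Real.pi 0)⟩
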